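/- Conventions. Modules are left modules and morphisms are composed from left to right, so that for an $A$-module $V$ and $\Lambda=\mathrm{End}_A(V)$ each $\mathrm{Hom}_A(V,X)$ is a left $\Lambda$-module. $A$-mod is the category of finitely generated $A$-modules, and $\mathrm{add}(M)$ consists of the direct summands of finite direct sums of copies of $M$. For an Artin $R$-algebra $\Lambda$ let $D=\mathrm{Hom}_R(-,E)$, where $E$ is the injective envelope of $R/\mathrm{rad}(R)$, let $\mathrm{Tr}$ be the transpose, $\tau^{-1}=\mathrm{Tr}D$, and $\Omega^{-m}$ the $m$-th co-syzygy. A $\Lambda$-module $T$ is *tilting* if it has a finite resolution by finitely generated projective modules, $\mathrm{Ext}^i_\Lambda(T,T)=0$ for all $i>0$, and there is an exact sequence $0\to\Lambda\to T^0\to\cdots\to T^m\to0$ with all $T^i\in\mathrm{add}(T)$. For $n\ge1$ it is *$n$-BB-tilting* if there is a simple $\Lambda$-module $S$ with (a) $\mathrm{Ext}^j_\Lambda(D(\Lambda),S)=0$ for $0\le j\le n-1$ and (b) $\mathrm{Ext}^i_\Lambda(S,S)=0$ for $1\le i\le n$, such that $T\cong\tau^{-1}\Omega^{-n+1}(S)\oplus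 P$, where $P$ is, up to multiplicities of direct summands, the direct sum of the indecomposable projective $\Lambda$-modules not isomorphic to the projective cover of $S$; that is, $P$ is finitely generated projective and an indecomposable finitely generated projective module is a direct summand of $P$ if and only if it is not isomorphic to the projective cover of $S$. An *Auslander–Reiten sequence* is a non-split exact sequence $0\to X\xrightarrow{f}M\xrightarrow{g}Y\to0$ in $A$-mod with $X$ and $Y$ indecomposable such that every morphism $W\to Y$ in $A$-mod that is not a split epimorphism factors through $g$ and every morphism $X\to W$ in $A$-mod that is not a split monomorphism factors through $f$. A functorially finite full subcategory $\mathcal C$ of $A$-mod is *maximal $(n-1)$-orthogonal* if $$\mathcal C=\{X\in A\text{-mod}\mid \mathrm{Ext}^i_A(C,X)=0\ \forall C\in\mathcal C,\,0<i\le n-1\}=\{X\in A\text{-mod}\mid \mathrm{Ext}^i_A(X,C)=0\ \forall C\in\mathcal C,\,0<i\le n-1\}.$$ An exact sequence $0\to X\xrightarrow{f}M_n\xrightarrow{t_n}M_{n-1}\to\cdots\xrightarrow{t_2}M_1\xrightarrow{g}Y\to0$ with terms in $\mathcal C$ is *$n$-almost split in $\mathcal C$* if all its maps $f,t_n,\dots,t_2,g$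 are radical maps and the induced sequences $$0\to\mathcal C(-,X)\to\mathcal C(-,M_n)\to\cdots\to\mathcal C(-,M_1)\to\mathrm{rad}_{\mathcal C}(-,Y)\to0,$$ $$0\to\mathcal C(Y,-)\to\mathcal C(M_1,-)\to\cdots\to\mathcal C(M_n,-)\to\mathrm{rad}_{\mathcal C}(X,-)\to0$$ are exact on $\mathcal C$, where $\mathrm{rad}_{\mathcal C}$ is the Jacobson radical of $\mathcal C$. Proposition. Let $n\ge1$. (1) Let $A$ be an Artin algebra and let $0\to X_i\to M_i\to X_{i-1}\to0$ be an Auslander–Reiten sequence in $A$-mod for $i=1,\dots,n$. Put $M=\bigoplus_{i=1}^nM_i$ and $V=M\oplus X_n$. If $X_n\notin\mathrm{add}(M)$ and $X_0,X_1,\dots,X_n$ are pairwise non-isomorphic, then the $\mathrm{End}_A(V)$-module $T=\mathrm{Hom}_A(V,X_0)\oplus\mathrm{Hom}_A(V,M)$ is a tilting module and an $n$-BB-tilting module. (2) Let $A$ be a finite-dimensional algebra over a field, $\mathcal C$ a maximal $(n-1)$-orthogonal subcategory of $A$-mod, and $X,Y\in\mathcal C$ indecomposable modules with an $n$-almost split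 sequence $$0\to X\xrightarrow{f}M_n\xrightarrow{t_n}M_{n-1}\to\cdots\xrightarrow{t_2}M_1\xrightarrow{g}Y\to0$$ in $\mathcal C$. Put $M=\bigoplus_{i=1}^nM_i$, $V=M\oplus X$, and let $L$ be the image of $\mathrm{Hom}_A(V,g)$. If $X\notin\mathrm{add}(M)$, then $\mathrm{Hom}_A(V,M)\oplus L$ is an $n$-BB-tilting $\mathrm{End}_A(V)$-module. -/

import Mathlib

universe u

namespace BBTilting

open CategoryTheory

/-! ### Modules over a ring -/

section Modules

variable {A : Type u} [Ring A]

/-- The module `X` is indecomposable: it is nonzero and not the internal direct sum of two nonzero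
submodules. -/
def IsIndec (A : Type u) [Ring A] (X : Type u) [AddCommGroup X] [Module A X] : Prop :=
  Nontrivial X ∧ ∀ p q : Submodule A X, IsCompl p q → p = ⊥ ∨ q = ⊥

/-- `X` is isomorphic to a direct summand of `Y`. -/
def IsSummand (A : Type u) [Ring A] (X Y : Type u) [AddCommGroup X] [Module A X]
    [AddCommGroup Y] [Module A Y] : Prop :=
  ∃ (i : X →ₗ[A] Y) (p : Y →ₗ[A] X), p ∘ₗ i = LinearMap.id

/-- `X ∈ add(Y)`: `X` is a direct summand of a finite direct sum of copies of `Y`. -/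
def InAdd (A : Type u) [Ring A] (X Y : Type u) [AddCommGroup X] [Module A X]
    [AddCommGroup Y] [Module A Y] : Prop :=
  ∃ m : ℕ, IsSummand A X (Fin m → Y)

/-- `Ext^i_A(X, Y) = 0`. -/
def ExtVanish (A : Type u) [Ring A] (X Y : Type u) [AddCommGroup X] [Module A X]
    [AddCommGroup Y] [Module A Y] (i : ℕ) : Prop :=
  Subsingleton (Abelian.Ext (ModuleCat.of A X) (ModuleCat.of A Y) i)

variable {X Y Z : Type u} [AddCommGroup X] [Module A X] [AddCommGroup Y] [Module A Y]
  [AddCommGroup Z] [Module A Z]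

/-- `0 → X → Y → Z → 0` is exact. -/
def IsShortExact (f : X →ₗ[A] Y) (g : Y →ₗ[A] Z) : Prop :=
  Function.Injective f ∧ Function.Exact f g ∧ Function.Surjective g

/-- `f : X → Y` belongs to the Jacobson radical of the category of modules
(equivalently, of any full subcategory containing `X` and `Y`). -/
def IsRadical (f : X →ₗ[A] Y) : Prop :=
  ∀ g : Y →ₗ[A] X, IsUnit (1 - (g ∘ₗ f : Module.End A X))

/-- `f : P → X` is a projective cover. -/
def IsProjCover (f : X →ₗ[A] Y) : Prop :=
  Module.Projective A X ∧ Function.Surjective f ∧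
    ∀ N : Submodule A X, N ⊔ LinearMap.ker f = ⊤ → N = ⊤

/-- `f : X → I` is an injective envelope. -/
def IsInjEnvelope (f : X →ₗ[A] Y) : Prop :=
  Module.Injective A Y ∧ Function.Injective f ∧
    ∀ N : Submodule A Y, N ⊓ LinearMap.range f = ⊥ → N = ⊥

/-- `0 → X → Y → Z → 0` is an Auslander-Reiten sequence of finitely generated modules. -/
structure IsARSequence (f : X →ₗ[A] Y) (g : Y →ₗ[A] Z) : Prop where
  finite_left : Module.Finite A X
  finite_middle : Module.Finite A Y
  finite_right : Module.Finite A Z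
  shortExact : IsShortExact f g
  not_split : ¬ ∃ s : Z →ₗ[A] Y, g ∘ₗ s = LinearMap.id
  indec_left : IsIndec A X
  indec_right : IsIndec A Z
  right_almost_split : ∀ (W : ModuleCat.{u} A), Module.Finite A W → ∀ h : W →ₗ[A] Z,
    (¬ ∃ s : Z →ₗ[A] W, h ∘ₗ s = LinearMap.id) → ∃ h' : W →ₗ[A] Y, g ∘ₗ h' = h
  left_almost_split : ∀ (W : ModuleCat.{u} A), Module.Finite A W → ∀ h : X →ₗ[A] W,
    (¬ ∃ r : W →ₗ[A] X, r ∘ₗ h = LinearMap.id) → ∃ h' : Y →ₗ[A] W, h' ∘ₗ f = h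

/-- `IsCosyzygy m X Y`: the module `Y` is an `m`-th cosyzygy `Ω^{-m}(X)` of `X`, obtained by
taking `m` times the cokernel of an injective envelope. -/
def IsCosyzygy : ℕ → ModuleCat.{u} A → ModuleCat.{u} A → Prop
  | 0, X, Y => Nonempty (X ≃ₗ[A] Y)
  | m + 1, X, Y => ∃ (I Z : ModuleCat.{u} A) (i : X →ₗ[A] I) (p : I →ₗ[A] Z),
      IsInjEnvelope i ∧ IsShortExact i p ∧ IsCosyzygy m Z Y

/-- `X` has a resolution `0 → P_m → ⋯ → P_0 → X → 0` by finitely generated projective modules. -/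
def HasProjRes : ℕ → ModuleCat.{u} A → Prop
  | 0, X => Module.Finite A X ∧ Module.Projective A X
  | m + 1, X => ∃ (K P : ModuleCat.{u} A) (i : K →ₗ[A] P) (p : P →ₗ[A] X),
      Module.Finite A P ∧ Module.Projective A P ∧ IsShortExact i p ∧ HasProjRes m K

/-- There is an exact sequence `0 → X → T^0 → ⋯ → T^m → 0` with all `T^i` in `add(T)`. -/
def HasAddCores (T : ModuleCat.{u} A) : ℕ → ModuleCat.{u} A → Prop
  | 0, X => InAdd A X T
  | m + 1, X => ∃ (T' Z : ModuleCat.{u} A) (i : X →ₗ[A] T') (p : T' →ₗ[A] Z),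
      InAdd A T' T ∧ IsShortExact i p ∧ HasAddCores T m Z

/-- `T` is a tilting module (of arbitrary finite projective dimension). -/
def IsTilting (A : Type u) [Ring A] (T : Type u) [AddCommGroup T] [Module A T] : Prop :=
  (∃ m, HasProjRes m (ModuleCat.of A T)) ∧ (∀ i, 0 < i → ExtVanish A T T i) ∧
    ∃ m, HasAddCores (ModuleCat.of A T) m (ModuleCat.of A A)

end Modules

/-! ### The duality, the transpose and `n`-BB-tilting modules

Here `Λ` is an Artin `R`-algebra, and `E` is the injective envelope of `R / rad R`.
Right modules are modules over the opposite ring. -/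

section Duality

/-- The right module `D(N) = Hom_R(N, E)` of a left `Λ`-module `N`, with `(φ λ)(x) = φ(λ x)`. -/
def DualOfLeft (R Λ E N : Type u) [CommRing R] [Ring Λ] [Algebra R Λ] [AddCommGroup E] [Module R E]
    [AddCommGroup N] [Module Λ N] : Type u :=
  RestrictScalars R Λ N →ₗ[R] E

instance (R Λ E N : Type u) [CommRing R] [Ring Λ] [Algebra R Λ] [AddCommGroup E] [Module R E]
    [AddCommGroup N] [Module Λ N] : AddCommGroup (DualOfLeft R Λ E N) :=
  inferInstanceAs (AddCommGroup (RestrictScalars R Λ N →ₗ[R] E))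

/-- Multiplication by an element of `Λ`, as an `R`-linear endomorphism of a `Λ`-module. -/
def mulMap (R Λ N : Type u) [CommRing R] [Ring Λ] [Algebra R Λ] [AddCommGroup N] [Module Λ N] :
    Λ →+* Module.End R (RestrictScalars R Λ N) :=
  (RestrictScalars.lsmul R Λ N).toRingHom

instance (R Λ E N : Type u) [CommRing R] [Ring Λ] [Algebra R Λ] [AddCommGroup E] [Module R E]
    [AddCommGroup N] [Module Λ N] : Module Λᵐᵒᵖ (DualOfLeft R Λ E N) where
  smul a φ := LinearMap.comp (φ : RestrictScalars R Λ N →ₗ[R] E) (mulMap R Λ N a.unop)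
  one_smul φ := by
    change LinearMap.comp (φ : RestrictScalars R Λ N →ₗ[R] E) (mulMap R Λ N 1) = φ
    rw [map_one]; rfl
  mul_smul a b φ := by
    change LinearMap.comp (φ : RestrictScalars R Λ N →ₗ[R] E)
      (mulMap R Λ N (b.unop * a.unop)) = _
    rw [map_mul]; rfl
  smul_zero a := LinearMap.zero_comp _
  smul_add a φ ψ := LinearMap.add_comp _ _ _
  add_smul a b φ := by
    change LinearMap.comp (φ : RestrictScalars R Λ N →ₗ[R] E)
      (mulMap R Λ N (a.unop + b.unop)) = _
    rw [map_add]; exact LinearMap.comp_add _ _ _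
  zero_smul φ := by
    change LinearMap.comp (φ : RestrictScalars R Λ N →ₗ[R] E) (mulMap R Λ N 0) = 0
    rw [map_zero]; exact LinearMap.comp_zero _

/-- The left module `D(Λ) = Hom_R(Λ, E)`, with `(λ φ)(x) = φ(x λ)`. -/
def DualRegular (R Λ E : Type u) [CommRing R] [Ring Λ] [Algebra R Λ] [AddCommGroup E]
    [Module R E] : Type u :=
  Λ →ₗ[R] E

instance (R Λ E : Type u) [CommRing R] [Ring Λ] [Algebra R Λ] [AddCommGroup E] [Module R E] :
    AddCommGroup (DualRegular R Λ E) :=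
  inferInstanceAs (AddCommGroup (Λ →ₗ[R] E))

instance (R Λ E : Type u) [CommRing R] [Ring Λ] [Algebra R Λ] [AddCommGroup E] [Module R E] :
    Module Λ (DualRegular R Λ E) where
  smul a φ := LinearMap.comp (φ : Λ →ₗ[R] E) (LinearMap.mulRight R a)
  one_smul φ := by
    change LinearMap.comp (φ : Λ →ₗ[R] E) (LinearMap.mulRight R 1) = φ
    rw [LinearMap.mulRight_one]; rfl
  mul_smul a b φ := by
    change LinearMap.comp (φ : Λ →ₗ[R] E) (LinearMap.mulRight R (a * b)) = _
    rw [LinearMap.mulRight_mul]; rfl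
  smul_zero a := LinearMap.zero_comp _
  smul_add a φ ψ := LinearMap.add_comp _ _ _
  add_smul a b φ := LinearMap.ext fun x =>
    (congrArg (show Λ →ₗ[R] E from φ) (mul_add x a b)).trans (map_add _ _ _)
  zero_smul φ := LinearMap.ext fun x =>
    (congrArg (show Λ →ₗ[R] E from φ) (mul_zero x)).trans (map_zero _)

/-- The left `Λ`-module `L` is the transpose `Tr(N)` of the right `Λ`-module `N`: for a minimal
projective presentation `P₁ → P₀ → N → 0` of right modules, `L` is the cokernel of the induced map
`Hom(P₀, Λ) → Hom(P₁, Λ)` of left `Λ`-modules. -/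
def IsTranspose (Λ N L : Type u) [Ring Λ] [AddCommGroup N] [Module Λᵐᵒᵖ N]
    [AddCommGroup L] [Module Λ L] : Prop :=
  ∃ (P₁ P₀ : ModuleCat.{u} Λᵐᵒᵖ) (d : P₁ →ₗ[Λᵐᵒᵖ] P₀) (e : P₀ →ₗ[Λᵐᵒᵖ] N)
    (hd : ∀ x, d x ∈ LinearMap.ker e),
    IsProjCover e ∧ IsProjCover (d.codRestrict (LinearMap.ker e) hd) ∧
    ∃ q : (P₁ →ₗ[Λᵐᵒᵖ] Λ) →ₗ[Λ] L,
      Function.Exact (fun φ : P₀ →ₗ[Λᵐᵒᵖ] Λ => φ ∘ₗ d) q ∧ Function.Surjective q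

/-- `P` is the direct sum of the indecomposable projective `Λ`-modules not isomorphic to `Q₀`,
up to multiplicities of direct summands. -/
def IsProjComplement (Λ P Q₀ : Type u) [Ring Λ] [AddCommGroup P] [Module Λ P]
    [AddCommGroup Q₀] [Module Λ Q₀] : Prop :=
  Module.Finite Λ P ∧ Module.Projective Λ P ∧
    ∀ Q : ModuleCat.{u} Λ, Module.Finite Λ Q → Module.Projective Λ Q → IsIndec Λ Q →
      (IsSummand Λ Q P ↔ ¬ Nonempty (Q ≃ₗ[Λ] Q₀))

/-- `T` is an `n`-BB-tilting module over the Artin `R`-algebra `Λ`: there is a simple module `S`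
with `Ext^j(D(Λ), S) = 0` for `0 ≤ j ≤ n - 1` and `Ext^i(S, S) = 0` for `1 ≤ i ≤ n`, such that
`T ≃ τ^{-1} Ω^{-n+1}(S) ⊕ P`, where `τ^{-1} = Tr D` and `P` is the direct sum of the indecomposable
projective modules that are not isomorphic to the projective cover of `S`. -/
def IsNBBTilting (R Λ : Type u) [CommRing R] [Ring Λ] [Algebra R Λ] (n : ℕ)
    (T : Type u) [AddCommGroup T] [Module Λ T] : Prop :=
  0 < n ∧
  ∃ (E : ModuleCat.{u} R) (ι : (R ⧸ Ring.jacobson R) →ₗ[R] E), IsInjEnvelope ι ∧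
  ∃ S : ModuleCat.{u} Λ, IsSimpleModule Λ S ∧
    (∀ j, j < n → ExtVanish Λ (DualRegular R Λ E) S j) ∧
    (∀ i, 1 ≤ i → i ≤ n → ExtVanish Λ S S i) ∧
  ∃ (K L PS P : ModuleCat.{u} Λ) (π : PS →ₗ[Λ] S),
    IsCosyzygy (n - 1) S K ∧ IsTranspose Λ (DualOfLeft R Λ E K) L ∧
    IsProjCover π ∧ IsProjComplement Λ P PS ∧ Nonempty (T ≃ₗ[Λ] L × P)

end Duality

/-! ### Modules over endomorphism rings

Morphisms are composed from left to right, so the endomorphism ring of `V` is the opposite of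
`Module.End A V`, and `Hom_A(V, X)` is a left module over it. -/

section Endomorphisms

/-- The endomorphism ring of `V`, with the product `λ μ` meaning "first `λ`, then `μ`". -/
abbrev EndRing (A V : Type u) [Ring A] [AddCommGroup V] [Module A V] : Type u :=
  (Module.End A V)ᵐᵒᵖ

/-- `Hom_A(V, X)` as a left module over the endomorphism ring of `V`; `λ • h` is "first `λ`, then
`h`". -/
def HomModule (A V X : Type u) [Ring A] [AddCommGroup V] [Module A V] [AddCommGroup X]
    [Module A X] : Type u :=
  V →ₗ[A] X

instance (A V X : Type u) [Ring A] [AddCommGroup V] [Module A V] [AddCommGroup X] [Module A X] :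
    AddCommGroup (HomModule A V X) :=
  inferInstanceAs (AddCommGroup (V →ₗ[A] X))

instance (A V X : Type u) [Ring A] [AddCommGroup V] [Module A V] [AddCommGroup X] [Module A X] :
    Module (EndRing A V) (HomModule A V X) where
  smul a h := LinearMap.comp (h : V →ₗ[A] X) a.unop
  one_smul _ := rfl
  mul_smul _ _ _ := rfl
  smul_zero _ := LinearMap.zero_comp _
  smul_add _ _ _ := LinearMap.add_comp _ _ _
  add_smul a b h := LinearMap.comp_add a.unop b.unop (h : V →ₗ[A] X)
  zero_smul h := LinearMap.comp_zero (h : V →ₗ[A] X)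

/-- `Hom_A(V, g) : Hom_A(V, X) → Hom_A(V, Y)`. -/
def homMap {A X Y : Type u} (V : Type u) [Ring A] [AddCommGroup V] [Module A V] [AddCommGroup X]
    [Module A X] [AddCommGroup Y] [Module A Y] (g : X →ₗ[A] Y) :
    HomModule A V X →ₗ[EndRing A V] HomModule A V Y where
  toFun h := LinearMap.comp g (h : V →ₗ[A] X)
  map_add' _ _ := LinearMap.comp_add _ _ _
  map_smul' _ _ := rfl

end Endomorphisms

/-! ### Maximal orthogonal subcategories and `n`-almost split sequences -/

section Orthogonal

variable {A : Type u} [Ring A]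

/-- The full subcategory `C` of the category of finitely generated modules is functorially finite:
each finitely generated module has a right and a left `C`-approximation. -/
def IsFunctoriallyFinite (C : ObjectProperty (ModuleCat.{u} A)) : Prop :=
  ∀ X : ModuleCat.{u} A, Module.Finite A X →
    (∃ (W : ModuleCat.{u} A) (f : W →ₗ[A] X), C W ∧
      ∀ U : ModuleCat.{u} A, C U → ∀ h : U →ₗ[A] X, ∃ h' : U →ₗ[A] W, f ∘ₗ h' = h) ∧
    (∃ (W : ModuleCat.{u} A) (f : X →ₗ[A] W), C W ∧
      ∀ U : ModuleCat.{u} A, C U → ∀ h : X →ₗ[A] U, ∃ h' : W →ₗ[A] U, h' ∘ₗ f = h)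

/-- `C` is a maximal `m`-orthogonal subcategory of the category of finitely generated modules. -/
structure IsMaxOrthogonal (C : ObjectProperty (ModuleCat.{u} A)) (m : ℕ) : Prop where
  finite : ∀ X, C X → Module.Finite A X
  functoriallyFinite : IsFunctoriallyFinite C
  right_orthogonal : ∀ X : ModuleCat.{u} A, Module.Finite A X →
    (C X ↔ ∀ U : ModuleCat.{u} A, C U → ∀ i, 0 < i → i ≤ m → ExtVanish A U X i)
  left_orthogonal : ∀ X : ModuleCat.{u} A, Module.Finite A X →
    (C X ↔ ∀ U : ModuleCat.{u} A, C U → ∀ i, 0 < i → i ≤ m → ExtVanish A X U i)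

variable {N : ℕ → Type u} [∀ i, AddCommGroup (N i)] [∀ i, Module A (N i)]

/-- The sequence `0 → N (n+1) → N n → ⋯ → N 1 → N 0 → 0` with maps `d i : N (i+1) → N i` for
`0 ≤ i ≤ n` is an `n`-almost split sequence in `C`. Modules and maps of larger index play no role.
-/
structure IsNAlmostSplit (C : ObjectProperty (ModuleCat.{u} A)) (n : ℕ)
    (d : ∀ i, N (i + 1) →ₗ[A] N i) : Prop where
  mem : ∀ i, i ≤ n + 1 → C (ModuleCat.of A (N i))
  radical : ∀ i, i ≤ n → IsRadical (d i)
  injective : Function.Injective (d n)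
  exact : ∀ i, i < n → Function.Exact (d (i + 1)) (d i)
  surjective : Function.Surjective (d 0)
  hom_from_injective : ∀ W : ModuleCat.{u} A, C W →
    Function.Injective fun h : W →ₗ[A] N (n + 1) => d n ∘ₗ h
  hom_from_exact : ∀ W : ModuleCat.{u} A, C W → ∀ i, i < n →
    Function.Exact (fun h : W →ₗ[A] N (i + 2) => d (i + 1) ∘ₗ h)
      (fun h : W →ₗ[A] N (i + 1) => d i ∘ₗ h)
  hom_from_radical : ∀ W : ModuleCat.{u} A, C W → ∀ h : W →ₗ[A] N 0,
    IsRadical h ↔ ∃ h' : W →ₗ[A] N 1, d 0 ∘ₗ h' = h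
  hom_to_injective : ∀ W : ModuleCat.{u} A, C W →
    Function.Injective fun h : N 0 →ₗ[A] W => h ∘ₗ d 0
  hom_to_exact : ∀ W : ModuleCat.{u} A, C W → ∀ i, i < n →
    Function.Exact (fun h : N i →ₗ[A] W => h ∘ₗ d i)
      (fun h : N (i + 1) →ₗ[A] W => h ∘ₗ d (i + 1))
  hom_to_radical : ∀ W : ModuleCat.{u} A, C W → ∀ h : N (n + 1) →ₗ[A] W,
    IsRadical h ↔ ∃ h' : N n →ₗ[A] W, h' ∘ₗ d n = h

end Orthogonal

end BBTilting

/-! Write Λ = End_A(V) and I(Z) = D Hom_A(Z, V), which is an injective Λ-module when Z is a summand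
of V. Both parts rest on `isNBBTilting_of_sequence`. It takes radical maps d_j : N_{j+1} → N_j for 0
≤ j ≤ n, where d_n is injective, N_1, …, N_{n+1} are summands of V, the sequence is exact at N_1, …,
N_n under Hom(V, -) and Hom(-, V), and every radical map N_{n+1} → V factors through d_n.

Let K_j be the kernel of I(N_{j+1}) → D Hom(N_j, V). Exactness of Hom(-, V) gives short exact
sequences 0 → K_{j+1} → I(N_{j+2}) → K_j → 0. Since the maps are radical, the inclusions K_j →
I(N_{j+1}) are injective envelopes for 1 ≤ j ≤ n. Since N_{n+1} has a local endomorphism ring, S =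
K_n is simple with projective cover Hom(V, N_{n+1}). Hence K_1 = Ω^{-n+1}(S). By Matlis duality
D(K_1) has the minimal presentation Hom(N_1, V) → Hom(N_2, V) → D(K_1) → 0. Applying Hom(-, Λ) turns
it into Hom(V, N_2) → Hom(V, N_1), whose cokernel is the image L of Hom(V, d_0). So L =
τ^{-1}Ω^{-n+1}(S).

The Ext conditions are dimension shifts along the same sequences. Hom(S, I(N_j)) = 0 for 1 ≤ j ≤ n,
because N_{n+1} is not a summand of M. Hom(DΛ, I(Z)) = Hom(V, Z), so Ext(DΛ, S) is controlled by
exactness of Hom(V, -).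

An n-almost split sequence satisfies these hypotheses directly. For (1) the Auslander–Reiten
sequences are spliced. The point there is that no X_j lies in add(M) (`not_isSummand_middle`), so
maps V → X_j lift and maps X_j → V extend for the relevant j. The same lifting makes 0 → Hom(V, X_n)
→ Hom(V, M_n) → ⋯ → Hom(V, M_1) → Hom(V, X_0) → 0 exact, which yields both the projective resolution
and the add(T)-coresolution required of a tilting module (`isTilting_of_chain`). -/

namespace BBTilting

open CategoryTheory

/-! ### Direct summands, local endomorphism rings and radical maps. -/

section Summands

variable {A : Type u} [Ring A]
variable {X Y Z : Type u} [AddCommGroup X] [Module A X] [AddCommGroup Y] [Module A Y]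
  [AddCommGroup Z] [Module A Z]

/-- Fitting's lemma: an indecomposable module of finite length has a local endomorphism ring. -/
theorem IsIndec.isLocalRing_end [IsNoetherian A X] [IsArtinian A X] (hX : IsIndec A X) :
    IsLocalRing (Module.End A X) := by
  have := hX.1
  refine IsLocalRing.of_isUnit_or_isUnit_one_sub_self fun f => ?_
  obtain ⟨k, hk, hk1⟩ := ((LinearMap.eventually_isCompl_ker_pow_range_pow f).and
    (Filter.eventually_ge_atTop 1)).exists
  rcases hX.2 _ _ hk with h | h
  · left
    have h1 : Function.Injective f := by
      rw [← LinearMap.ker_eq_bot, eq_bot_iff, ← h]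
      intro x hx
      obtain ⟨m, rfl⟩ := Nat.exists_eq_add_of_le' hk1
      rw [LinearMap.mem_ker, pow_succ, Module.End.mul_apply, LinearMap.mem_ker.1 hx, map_zero]
    exact (Module.End.isUnit_iff f).2 (IsArtinian.bijective_of_injective_endomorphism f h1)
  · right
    have : f ^ k = 0 := LinearMap.range_eq_bot.1 h
    exact IsNilpotent.isUnit_one_sub ⟨k, this⟩

theorem IsSummand.of_isUnit {f : X →ₗ[A] Y} {g : Y →ₗ[A] X}
    (h : IsUnit (g ∘ₗ f : Module.End A X)) : IsSummand A X Y := by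
  obtain ⟨v, hv⟩ := h.exists_left_inv
  exact ⟨f, v ∘ₗ g, by rw [LinearMap.comp_assoc]; exact hv⟩

theorem IsSummand.trans (h : IsSummand A X Y) (h' : IsSummand A Y Z) : IsSummand A X Z := by
  obtain ⟨i, p, h⟩ := h
  obtain ⟨j, q, h'⟩ := h'
  exact ⟨j ∘ₗ i, p ∘ₗ q, by rw [LinearMap.comp_assoc, ← LinearMap.comp_assoc i, h',
    LinearMap.id_comp, h]⟩

theorem IsSummand.of_equiv (e : X ≃ₗ[A] Y) : IsSummand A X Y :=
  ⟨e, e.symm, by ext; simp⟩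

theorem isSummand_pi {ι : Type} [Fintype ι] [DecidableEq ι] {Y : ι → Type u}
    [∀ i, AddCommGroup (Y i)] [∀ i, Module A (Y i)] (i : ι) : IsSummand A (Y i) (Π i, Y i) :=
  ⟨LinearMap.single A Y i, LinearMap.proj i, by ext; simp⟩

theorem IsSummand.inAdd (h : IsSummand A X Y) : InAdd A X Y :=
  ⟨1, h.trans (isSummand_pi (Y := fun _ : Fin 1 => Y) 0)⟩

/-- The identity of `X` is the sum of its components through the factors, and in a local ring some
summand of a unit is a unit. -/
theorem IsSummand.exists_of_pi [IsLocalRing (Module.End A X)] {ι : Type} [Fintype ι]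
    [DecidableEq ι] {Y : ι → Type u} [∀ i, AddCommGroup (Y i)] [∀ i, Module A (Y i)]
    (h : IsSummand A X (Π i, Y i)) : ∃ i, IsSummand A X (Y i) := by
  obtain ⟨s, p, h⟩ := h
  have h1 : ∑ j, ((p ∘ₗ LinearMap.single A Y j) ∘ₗ (LinearMap.proj j ∘ₗ s) : Module.End A X)
      = 1 := by
    ext x
    have := LinearMap.congr_fun h x
    simp only [LinearMap.coe_sum, Finset.sum_apply, LinearMap.comp_apply, LinearMap.proj_apply,
      LinearMap.id_apply, Module.End.one_apply] at this ⊢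
    rw [← map_sum]
    conv_rhs => rw [← this]
    congr 1
    exact LinearMap.sum_single_apply Y (s x)
  obtain ⟨j, -, hj⟩ := IsLocalRing.exists_of_isUnit_sum (h1 ▸ isUnit_one)
  exact ⟨j, IsSummand.of_isUnit hj⟩

theorem IsSummand.or_of_prod [IsLocalRing (Module.End A X)]
    (h : IsSummand A X (Y × Z)) : IsSummand A X Y ∨ IsSummand A X Z := by
  obtain ⟨s, p, h⟩ := h
  have h1 : ((p ∘ₗ LinearMap.inl A Y Z) ∘ₗ (LinearMap.fst A Y Z ∘ₗ s) : Module.End A X) +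
      (p ∘ₗ LinearMap.inr A Y Z) ∘ₗ (LinearMap.snd A Y Z ∘ₗ s) = 1 := by
    ext x
    have := LinearMap.congr_fun h x
    simp only [LinearMap.add_apply, LinearMap.comp_apply, Module.End.one_apply,
      LinearMap.id_apply] at this ⊢
    rw [← map_add]
    simpa using this
  rcases IsLocalRing.isUnit_or_isUnit_of_add_one h1 with h | h
  · exact .inl (IsSummand.of_isUnit h)
  · exact .inr (IsSummand.of_isUnit h)

/-- A retraction splits `Y` as range i ⊕ ker p, and the first part is nonzero. -/
theorem IsIndec.bijective_of_retraction (hY : IsIndec A Y) [Nontrivial X] {i : X →ₗ[A] Y}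
    {p : Y →ₗ[A] X} (h : p ∘ₗ i = LinearMap.id) : Function.Bijective i ∧ Function.Bijective p := by
  have hpi : ∀ x, p (i x) = x := LinearMap.congr_fun h
  have hi : Function.Injective i := Function.LeftInverse.injective hpi
  have hp : Function.Surjective p := Function.RightInverse.surjective hpi
  have hc : IsCompl (LinearMap.range i) (LinearMap.ker p) := by
    refine IsCompl.of_eq ?_ ?_
    · rw [eq_bot_iff]
      rintro _ ⟨⟨x, rfl⟩, hx⟩
      have hx : p (i x) = 0 := hx
      rw [hpi] at hx
      simp [hx]
    · rw [eq_top_iff]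
      intro y _
      rw [← add_sub_cancel (i (p y)) y]
      exact Submodule.add_mem_sup ⟨_, rfl⟩ (by simp [hpi])
  rcases hY.2 _ _ hc with h0 | h0
  · exfalso
    have := LinearMap.range_eq_bot.1 h0
    obtain ⟨x, hx⟩ := exists_ne (0 : X)
    exact hx (hi (by simp [this]))
  · have hp' := LinearMap.ker_eq_bot.1 h0
    exact ⟨⟨hi, fun y => ⟨p y, hp' (hpi _)⟩⟩, hp', hp⟩

theorem IsSummand.nonempty_equiv (hY : IsIndec A Y) [Nontrivial X] (h : IsSummand A X Y) :
    Nonempty (X ≃ₗ[A] Y) := by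
  obtain ⟨i, p, h⟩ := h
  exact ⟨LinearEquiv.ofBijective i (hY.bijective_of_retraction h).1⟩

theorem IsIndec.congr (hX : IsIndec A X) (e : X ≃ₗ[A] Y) : IsIndec A Y := by
  have := hX.1
  refine ⟨e.symm.toEquiv.nontrivial, fun p q h => ?_⟩
  have := hX.2 (p.comap (e : X →ₗ[A] Y)) (q.comap (e : X →ₗ[A] Y))
    ((Submodule.orderIsoMapComap e).symm.isCompl h)
  simpa [Submodule.comap_equiv_eq_map_symm] using this

/-- If v inverts 1 - gf, then 1 + fvg inverts 1 - fg. This makes the radical left-right symmetric.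
-/
theorem isUnit_one_sub_comp_comm (f : X →ₗ[A] Y) (g : Y →ₗ[A] X)
    (h : IsUnit (1 - (g ∘ₗ f : Module.End A X))) : IsUnit (1 - (f ∘ₗ g : Module.End A Y)) := by
  obtain ⟨⟨_, v, h1, h2⟩, rfl⟩ := h
  have h1' : ∀ x, v x - g (f (v x)) = x := fun x => LinearMap.congr_fun h1 x
  have h2' : ∀ x, v (x - g (f x)) = x := fun x => LinearMap.congr_fun h2 x
  refine ⟨⟨1 - (f ∘ₗ g : Module.End A Y), 1 + f ∘ₗ v ∘ₗ g, ?_, ?_⟩, rfl⟩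
  · ext y
    simp only [Module.End.mul_apply, LinearMap.sub_apply, LinearMap.add_apply,
      Module.End.one_apply, LinearMap.comp_apply]
    have := congrArg f (h1' (g y))
    simp only [map_sub, map_add] at this ⊢
    rw [← this]; abel
  · ext y
    simp only [Module.End.mul_apply, LinearMap.sub_apply, LinearMap.add_apply,
      Module.End.one_apply, LinearMap.comp_apply]
    have := congrArg f (h2' (g y))
    simp only [map_sub] at this ⊢
    rw [this]; abel

theorem IsRadical.comp_left {f : X →ₗ[A] Y} (hf : IsRadical f) (h : Y →ₗ[A] Z) :
    IsRadical (h ∘ₗ f) := fun g => hf (g ∘ₗ h)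

theorem IsRadical.isUnit_one_sub {f : X →ₗ[A] Y} (hf : IsRadical f) (g : Y →ₗ[A] X) :
    IsUnit (1 - (f ∘ₗ g : Module.End A Y)) := isUnit_one_sub_comp_comm f g (hf g)

theorem isRadical_of_isUnit_one_sub {f : X →ₗ[A] Y}
    (hf : ∀ g : Y →ₗ[A] X, IsUnit (1 - (f ∘ₗ g : Module.End A Y))) : IsRadical f :=
  fun g => isUnit_one_sub_comp_comm g f (hf g)

theorem IsRadical.comp_right {f : Y →ₗ[A] Z} (hf : IsRadical f) (h : X →ₗ[A] Y) :
    IsRadical (f ∘ₗ h) := isRadical_of_isUnit_one_sub fun g => hf.isUnit_one_sub (h ∘ₗ g)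

theorem isRadical_of_no_retraction [IsLocalRing (Module.End A X)] {f : X →ₗ[A] Y}
    (hf : ¬ ∃ r : Y →ₗ[A] X, r ∘ₗ f = LinearMap.id) : IsRadical f := by
  intro g
  rcases IsLocalRing.isUnit_or_isUnit_of_add_one
    (add_sub_cancel (g ∘ₗ f : Module.End A X) 1) with h | h
  · obtain ⟨v, hv⟩ := h.exists_left_inv
    exact absurd ⟨v ∘ₗ g, by rw [LinearMap.comp_assoc]; exact hv⟩ hf
  · exact h

theorem isRadical_of_no_section [IsLocalRing (Module.End A Y)] {f : X →ₗ[A] Y}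
    (hf : ¬ ∃ s : Y →ₗ[A] X, f ∘ₗ s = LinearMap.id) : IsRadical f := by
  refine isRadical_of_isUnit_one_sub fun g => ?_
  rcases IsLocalRing.isUnit_or_isUnit_of_add_one
    (add_sub_cancel (f ∘ₗ g : Module.End A Y) 1) with h | h
  · obtain ⟨v, hv⟩ := h.exists_right_inv
    exact absurd ⟨g ∘ₗ v, by rw [← LinearMap.comp_assoc]; exact hv⟩ hf
  · exact h

theorem IsRadical.no_retraction [Nontrivial X] {f : X →ₗ[A] Y} (hf : IsRadical f)
    (r : Y →ₗ[A] X) : r ∘ₗ f ≠ LinearMap.id := by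
  intro h
  have := hf r
  rw [h] at this
  change IsUnit (1 - (1 : Module.End A X)) at this
  rw [sub_self, isUnit_zero_iff] at this
  exact zero_ne_one this

/-- A non-radical map out of a module with local endomorphism ring is a split monomorphism. -/
theorem exists_retraction_of_not_isRadical [IsLocalRing (Module.End A X)] {f : X →ₗ[A] Y}
    (hf : ¬ IsRadical f) : ∃ r : Y →ₗ[A] X, r ∘ₗ f = LinearMap.id := by
  by_contra h
  exact hf (isRadical_of_no_retraction h)

/-- This links the categorical radical with rad Λ: elements of a Λ-module killed by rad Λ are killed
by all endomorphisms of `V` factoring through a radical map. -/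
theorem IsRadical.op_mem_jacobson {V : Type u} [AddCommGroup V] [Module A V] {h : X →ₗ[A] V}
    (hh : IsRadical h) (p : V →ₗ[A] X) :
    MulOpposite.op (h ∘ₗ p : Module.End A V) ∈ Ring.jacobson (EndRing A V) := by
  rw [← Ideal.jacobson_bot, Ideal.mem_jacobson_iff]
  intro y
  obtain ⟨v, hv⟩ := (hh.isUnit_one_sub (-(p ∘ₗ y.unop))).exists_right_inv
  refine ⟨MulOpposite.op v, ?_⟩
  rw [Submodule.mem_bot, sub_eq_zero]
  apply MulOpposite.unop_injective
  rw [← MulOpposite.op_unop y]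
  rw [LinearMap.comp_neg, sub_neg_eq_add] at hv
  rw [MulOpposite.unop_one, ← hv, ← LinearMap.comp_assoc]
  simp only [MulOpposite.unop_add, MulOpposite.unop_mul, MulOpposite.unop_op, add_mul, one_mul,
    mul_assoc, ← Module.End.mul_eq_comp]
  rw [add_comm]

end Summands

/-! ### Existence of injective envelopes. -/

section InjectiveHull

variable {R : Type u} [Ring R]

theorem injective_of_retract {Q I : Type u} [AddCommGroup Q] [Module R Q] [AddCommGroup I]
    [Module R I] (hI : Module.Injective R I) (i : Q →ₗ[R] I) (p : I →ₗ[R] Q)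
    (h : p ∘ₗ i = LinearMap.id) : Module.Injective R Q where
  out X Y _ _ _ _ f hf g := by
    obtain ⟨l, hl⟩ := hI.out f hf (i ∘ₗ g)
    refine ⟨p ∘ₗ l, fun x => ?_⟩
    rw [LinearMap.comp_apply, hl]
    exact LinearMap.congr_fun h (g x)

/-- Zorn's lemma applies because intersection distributes over directed suprema: a submodule of the
union of a chain is the union of its intersections with the members. -/
theorem exists_maximal_essential {I : Type u} [AddCommGroup I] [Module R I]
    (X : Submodule R I) : ∃ Q, X ≤ Q ∧ (∀ N ≤ Q, N ⊓ X = ⊥ → N = ⊥) ∧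
      ∀ Q', Q ≤ Q' → (∀ N ≤ Q', N ⊓ X = ⊥ → N = ⊥) → Q' = Q := by
  obtain ⟨Q, hXQ, hQ⟩ := zorn_le_nonempty₀
    {Q : Submodule R I | ∀ N ≤ Q, N ⊓ X = ⊥ → N = ⊥} (fun c hc hcc y hy => by
      refine ⟨sSup c, fun N hN hNX => ?_, fun z hz => le_sSup hz⟩
      rw [← inf_eq_left.2 hN, hcc.directedOn.inf_sSup_eq]
      simp only [iSup_eq_bot]
      intro q hq
      exact hc hq _ inf_le_right (by
        rw [eq_bot_iff, ← hNX]
        exact inf_le_inf_right _ inf_le_left)) X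
    (fun N hN h => by rwa [inf_eq_left.2 hN] at h)
  exact ⟨Q, hXQ, hQ.prop, fun Q' hle h => le_antisymm (hQ.2 h hle) hle⟩

theorem exists_maximal_disjoint {I : Type u} [AddCommGroup I] [Module R I]
    (Q : Submodule R I) : ∃ N : Submodule R I, N ⊓ Q = ⊥ ∧
      ∀ N', N ≤ N' → N' ⊓ Q = ⊥ → N' = N := by
  obtain ⟨N, -, hN⟩ := zorn_le_nonempty₀
    {N : Submodule R I | N ⊓ Q = ⊥} (fun c hc hcc y hy => by
      refine ⟨sSup c, ?_, fun z hz => le_sSup hz⟩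
      rw [Set.mem_ofPred_eq, inf_comm, hcc.directedOn.inf_sSup_eq]
      simp only [iSup_eq_bot]
      intro q hq
      rw [inf_comm]
      exact hc hq) ⊥ (by simp)
  exact ⟨N, hN.prop, fun Q' hle h => le_antisymm (hN.2 h hle) hle⟩

/-- Choose N maximal with N ∩ Q = 0. Then Q embeds in I/N, and the inclusion Q → I extends to g :
I/N → I. The image of g is an essential extension of X containing Q, hence equals Q, and g composed
with I → I/N retracts I onto Q. -/
theorem injective_of_maximal_essential {I : Type u} [AddCommGroup I] [Module R I]
    (hI : Module.Injective R I) {X Q : Submodule R I} (hXQ : X ≤ Q)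
    (hQ : ∀ N ≤ Q, N ⊓ X = ⊥ → N = ⊥)
    (hmax : ∀ Q', Q ≤ Q' → (∀ N ≤ Q', N ⊓ X = ⊥ → N = ⊥) → Q' = Q) : Module.Injective R Q := by
  obtain ⟨N, hN, hNmax⟩ := exists_maximal_disjoint Q
  have hinj : Function.Injective (N.mkQ ∘ₗ Q.subtype) := by
    rw [← LinearMap.ker_eq_bot, eq_bot_iff]
    intro q hq
    have : (q : I) ∈ N ⊓ Q := ⟨by simpa using hq, q.2⟩
    rw [hN] at this
    simpa using this
  obtain ⟨g, hg⟩ := hI.out _ hinj Q.subtype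
  have hg' : ∀ q ∈ Q, g (N.mkQ q) = q := fun q hq => hg ⟨q, hq⟩
  have hginj : ∀ y, g y = 0 → y = 0 := by
    intro y hy
    obtain ⟨y, rfl⟩ := N.mkQ_surjective y
    have := hNmax (LinearMap.ker (g ∘ₗ N.mkQ)) (fun z hz => by
      have : N.mkQ z = 0 := by simpa using hz
      rw [LinearMap.mem_ker, LinearMap.comp_apply, this, map_zero]) (by
      rw [eq_bot_iff]
      rintro z ⟨hz, hzQ⟩
      rw [SetLike.mem_coe, LinearMap.mem_ker, LinearMap.comp_apply, hg' z hzQ] at hz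
      simp [hz])
    have hy' : y ∈ LinearMap.ker (g ∘ₗ N.mkQ) := hy
    rw [this] at hy'
    simpa using hy'
  have hrange : LinearMap.range (g ∘ₗ N.mkQ) = Q := by
    refine hmax _ (fun q hq => ⟨q, hg' q hq⟩) fun T hT hTX => ?_
    have h1 : T ⊓ Q = ⊥ := hQ _ inf_le_right (by
      rw [inf_assoc, inf_eq_right.2 hXQ, hTX])
    have h2 : T.comap (g ∘ₗ N.mkQ) = N := hNmax _ (fun z hz => by
      have : N.mkQ z = 0 := by simpa using hz
      rw [Submodule.mem_comap, LinearMap.comp_apply, this, map_zero]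
      exact T.zero_mem) (by
      rw [eq_bot_iff]
      rintro z ⟨hz, hzQ⟩
      rw [SetLike.mem_coe, Submodule.mem_comap, LinearMap.comp_apply, hg' z hzQ] at hz
      rw [← h1]
      exact ⟨hz, hzQ⟩)
    rw [eq_bot_iff]
    intro t ht
    obtain ⟨z, rfl⟩ := hT ht
    have : z ∈ T.comap (g ∘ₗ N.mkQ) := ht
    rw [h2] at this
    have : N.mkQ z = 0 := by simpa using this
    simp only [LinearMap.comp_apply, this, map_zero, Submodule.zero_mem]
  refine injective_of_retract hI Q.subtype
    ((g ∘ₗ N.mkQ).codRestrict Q fun z => hrange ▸ LinearMap.mem_range_self _ z) ?_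
  ext q
  exact hg' q q.2

theorem exists_isInjEnvelope (X : Type u) [AddCommGroup X] [Module R X] :
    ∃ (E : ModuleCat.{u} R) (i : X →ₗ[R] E), IsInjEnvelope i := by
  let J := Injective.under (ModuleCat.of R X)
  have : Injective (ModuleCat.of R J) :=
    inferInstanceAs (Injective (Injective.under (ModuleCat.of R X)))
  have hJ : Module.Injective R J := Module.injective_module_of_injective_object R J
  let i : X →ₗ[R] J := (Injective.ι (ModuleCat.of R X)).hom
  have hi : Function.Injective i := (ModuleCat.mono_iff_injective _).1 inferInstance
  obtain ⟨Q, hXQ, hQ, hmax⟩ := exists_maximal_essential (LinearMap.range i)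
  refine ⟨ModuleCat.of R Q, i.codRestrict Q fun x => hXQ ⟨x, rfl⟩,
    injective_of_maximal_essential hJ hXQ hQ hmax, fun x y h => hi (congrArg Subtype.val h),
    fun N hN => ?_⟩
  have h := hQ (N.map Q.subtype) (Submodule.map_subtype_le Q N) (by
    rw [eq_bot_iff]
    rintro _ ⟨⟨z, hz, rfl⟩, x, hx⟩
    have : z ∈ N ⊓ LinearMap.range (i.codRestrict Q fun x => hXQ ⟨x, rfl⟩) :=
      ⟨hz, x, Subtype.ext hx⟩
    rw [hN] at this
    have : z = 0 := this
    simp [this])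
  exact Submodule.map_injective_of_injective Q.injective_subtype (h.trans (Submodule.map_bot _).symm)

end InjectiveHull

/-! ### Matlis duality over a commutative Artinian ring. -/

section Matlis

theorem exists_comp_eq_of_ker_le {R X Y Z : Type*} [Ring R] [AddCommGroup X] [Module R X]
    [AddCommGroup Y] [Module R Y] [AddCommGroup Z] [Module R Z] {f : X →ₗ[R] Y} (g : X →ₗ[R] Z)
    (hf : Function.Surjective f) (h : LinearMap.ker f ≤ LinearMap.ker g) :
    ∃ k : Y →ₗ[R] Z, k ∘ₗ f = g := by
  refine ⟨(LinearMap.ker f).liftQ g h ∘ₗ (f.quotKerEquivOfSurjective hf).symm, ?_⟩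
  ext x
  have : (f.quotKerEquivOfSurjective hf).symm (f x) = (LinearMap.ker f).mkQ x := by
    rw [LinearEquiv.symm_apply_eq]; rfl
  simp [this]

variable {R : Type u} [CommRing R] {E : Type u} [AddCommGroup E] [Module R E]
  {ι : (R ⧸ Ring.jacobson R) →ₗ[R] E}

theorem mem_ringJacobson_iff {r : R} :
    r ∈ Ring.jacobson R ↔ ∀ m : Ideal R, m.IsMaximal → r ∈ m := by
  rw [Ring.jacobson_eq_sInf_isMaximal, Ideal.mem_sInf]
  rfl

/-- There are finitely many maximal ideals, so some r lies in all of them except m. Its class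
generates a copy of R/m inside R/rad R. -/
theorem exists_not_mem_mul_mem_jacobson [IsArtinianRing R] (m : Ideal R) [hm : m.IsMaximal] :
    ∃ r ∉ m, ∀ a ∈ m, a * r ∈ Ring.jacobson R := by
  classical
  have hfin := IsArtinianRing.setOfPred_isMaximal_finite R
  let s : Finset (Ideal R) := hfin.toFinset.erase m
  have h : ¬ s.inf id ≤ m := by
    intro h
    obtain ⟨p, hp, hpm⟩ := (Ideal.IsPrime.inf_le' hm.isPrime).1 h
    have hp' : p ≠ m ∧ p.IsMaximal := by simpa [s] using hp
    exact hp'.1 (hp'.2.eq_of_le hm.ne_top hpm)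
  obtain ⟨r, hr, hrm⟩ := SetLike.not_le_iff_exists.1 h
  refine ⟨r, hrm, fun a ha => mem_ringJacobson_iff.2 fun p hp => ?_⟩
  by_cases hpm : p = m
  · exact hpm ▸ m.mul_mem_right r ha
  · have hps : p ∈ s := by simp [s, hpm, hp]
    exact p.mul_mem_left a ((Finset.inf_le hps : s.inf id ≤ p) hr)

/-- The injective envelope of `R / rad R` is a cogenerator. -/
theorem IsInjEnvelope.exists_apply_ne_zero [IsArtinianRing R] (hι : IsInjEnvelope ι)
    {N : Type u} [AddCommGroup N] [Module R N] {x : N} (hx : x ≠ 0) :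
    ∃ φ : N →ₗ[R] E, φ x ≠ 0 := by
  have := hι.1
  let f := LinearMap.toSpanSingleton R N x
  have hne : LinearMap.ker f ≠ ⊤ := by
    intro h
    have : (1 : R) ∈ LinearMap.ker f := h ▸ Submodule.mem_top
    exact hx (by simpa [f] using this)
  obtain ⟨m, hm, hfm⟩ := Ideal.exists_le_maximal (LinearMap.ker f) hne
  obtain ⟨r, hr, hmr⟩ := exists_not_mem_mul_mem_jacobson m
  let g : R →ₗ[R] E := ι ∘ₗ LinearMap.toSpanSingleton R _ (Submodule.Quotient.mk r)
  have hg : LinearMap.ker f ≤ LinearMap.ker g := by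
    intro a ha
    have h1 : (a • Submodule.Quotient.mk r : R ⧸ Ring.jacobson R) = 0 := by
      rw [← Submodule.Quotient.mk_smul, Submodule.Quotient.mk_eq_zero]
      exact hmr a (hfm ha)
    rw [LinearMap.mem_ker, LinearMap.comp_apply, LinearMap.toSpanSingleton_apply, h1, map_zero]
  obtain ⟨φ, hφ⟩ := Module.Injective.extension_property R E _ _
    ((LinearMap.ker f).liftQ f le_rfl) (by
      rw [← LinearMap.ker_eq_bot, Submodule.ker_liftQ_eq_bot _ _ _ le_rfl])
    ((LinearMap.ker f).liftQ g hg)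
  refine ⟨φ, fun h => ?_⟩
  have h1 := LinearMap.congr_fun hφ (Submodule.Quotient.mk 1)
  simp only [LinearMap.comp_apply, Submodule.liftQ_apply] at h1
  rw [show f 1 = x by simp [f], h] at h1
  have h2 : (Submodule.Quotient.mk r : R ⧸ Ring.jacobson R) = 0 := by
    apply hι.2.1
    rw [map_zero, h1]
    simp [g]
  rw [Submodule.Quotient.mk_eq_zero] at h2
  exact hr (mem_ringJacobson_iff.1 h2 m hm)

/-- For x ≠ 0, the module Rx is simple and meets the essential submodule R/rad R, so it lies inside
it. -/
theorem IsInjEnvelope.mem_range_of_smul_eq_zero (hι : IsInjEnvelope ι) (m : Ideal R)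
    [hm : m.IsMaximal] {x : E} (hmx : ∀ a ∈ m, a • x = 0) : x ∈ LinearMap.range ι := by
  by_cases hx : x = 0
  · exact hx ▸ Submodule.zero_mem _
  have h : (R ∙ x) ⊓ LinearMap.range ι ≠ ⊥ := fun h =>
    hx (Submodule.span_singleton_eq_bot.1 (hι.2.2 _ h))
  obtain ⟨y, ⟨hy, hyι⟩, hy0⟩ := Submodule.exists_mem_ne_zero_of_ne_bot h
  obtain ⟨r, rfl⟩ := Submodule.mem_span_singleton.1 hy
  have hr : r ∉ m := fun h => hy0 (hmx r h)
  obtain ⟨t, i, hi, ht⟩ := hm.exists_inv hr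
  have : x = t • (r • x) := by
    have h1 := congrArg (· • x) ht
    simp only [add_smul, mul_smul, hmx i hi, add_zero, one_smul] at h1
    exact h1.symm
  rw [this]
  exact Submodule.smul_mem _ t hyι

/-- The m-torsion of `E` is at most one-dimensional over R/m: it already lies in R/rad R, where a
representative of x is outside m and hence invertible modulo m. -/
theorem IsInjEnvelope.exists_smul_eq (hι : IsInjEnvelope ι) (m : Ideal R)
    [hm : m.IsMaximal] {x y : E} (hx : x ≠ 0) (hmx : ∀ a ∈ m, a • x = 0)
    (hmy : ∀ a ∈ m, a • y = 0) : ∃ r : R, y = r • x := by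
  obtain ⟨a, rfl⟩ := hι.mem_range_of_smul_eq_zero m hmx
  obtain ⟨b, rfl⟩ := hι.mem_range_of_smul_eq_zero m hmy
  obtain ⟨a, rfl⟩ := Submodule.Quotient.mk_surjective _ a
  obtain ⟨b, rfl⟩ := Submodule.Quotient.mk_surjective _ b
  have key : ∀ c r : R, r • ι (Submodule.Quotient.mk c) = 0 ↔ r * c ∈ Ring.jacobson R := by
    intro c r
    rw [← map_smul, ← Submodule.Quotient.mk_smul, map_eq_zero_iff ι hι.2.1,
      Submodule.Quotient.mk_eq_zero, smul_eq_mul]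
  simp only [key] at hmx hmy
  have ha : a ∉ m := by
    intro ham
    have h1 : a ∉ Ring.jacobson R := by
      intro h
      apply hx
      rw [(Submodule.Quotient.mk_eq_zero _).2 h, map_zero]
    apply h1
    refine mem_ringJacobson_iff.2 fun p hp => ?_
    by_contra hap
    have hle : m ≤ p := fun z hz =>
      (hp.isPrime.mem_or_mem (mem_ringJacobson_iff.1 (hmx z hz) p hp)).resolve_right hap
    exact hap (hle ham)
  obtain ⟨t, i, hi, ht⟩ := hm.exists_inv ha
  refine ⟨t * b, ?_⟩
  rw [← map_smul, ← Submodule.Quotient.mk_smul]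
  congr 1
  rw [Submodule.Quotient.eq]
  have : b - (t * b) • a = i * b := by
    rw [smul_eq_mul]
    linear_combination (-b) * ht
  rw [this]
  exact hmy i hi

/-- Modules of finite length are reflexive with respect to `Hom_R(-, E)`. -/
theorem IsInjEnvelope.exists_eval_eq [IsArtinianRing R] (hι : IsInjEnvelope ι)
    {N : Type u} [AddCommGroup N] [Module R N] (hN : IsFiniteLength R N)
    (F : (N →ₗ[R] E) →ₗ[R] E) : ∃ n : N, ∀ φ, F φ = φ n := by
  have := hι.1
  induction hN with
  | of_subsingleton => exact ⟨0, fun φ => by rw [Subsingleton.elim φ 0, map_zero]; rfl⟩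
  | @of_simple_quotient M _ _ N _ _ ih =>
    -- For the simple quotient, all values at a generator n lie in one line of m-torsion. So every
    -- form is a multiple of φ₀, and F is determined by its value there.
    obtain ⟨c, hc⟩ : ∃ c : M ⧸ N, ∀ φ : (M ⧸ N) →ₗ[R] E, F (φ ∘ₗ N.mkQ) = φ c := by
      have := IsSimpleModule.nontrivial R (M ⧸ N)
      obtain ⟨n, hn⟩ := exists_ne (0 : M ⧸ N)
      obtain ⟨φ₀, h0⟩ := hι.exists_apply_ne_zero hn
      have hsurj := IsSimpleModule.toSpanSingleton_surjective R hn
      let m : Ideal R := LinearMap.ker (LinearMap.toSpanSingleton R (M ⧸ N) n)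
      have hm : m.IsMaximal := IsSimpleModule.ker_toSpanSingleton_isMaximal R hn
      have hmn : ∀ a ∈ m, a • n = 0 := fun a ha => by simpa [m] using ha
      have hzero : ∀ a ∈ m, ∀ φ : (M ⧸ N) →ₗ[R] E, a • φ = 0 := by
        intro a ha φ
        ext z
        obtain ⟨r, hr⟩ := hsurj (N.mkQ z)
        rw [LinearMap.toSpanSingleton_apply] at hr
        rw [LinearMap.comp_apply, ← hr, LinearMap.smul_apply, ← map_smul, smul_comm, hmn a ha]
        simp
      have hev : ∀ φ : (M ⧸ N) →ₗ[R] E, ∀ a ∈ m, a • φ n = 0 := fun φ a ha => by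
        rw [← map_smul, hmn a ha, map_zero]
      obtain ⟨s, hs⟩ := hι.exists_smul_eq m h0 (hev φ₀) (y := F (φ₀ ∘ₗ N.mkQ)) (fun a ha => by
        rw [← map_smul, ← LinearMap.smul_comp, hzero a ha, LinearMap.zero_comp, map_zero])
      refine ⟨s • n, fun φ => ?_⟩
      obtain ⟨r, hr⟩ := hι.exists_smul_eq m h0 (hev φ₀) (hev φ)
      have : φ = r • φ₀ := by
        ext z
        obtain ⟨t, ht⟩ := hsurj (N.mkQ z)
        rw [LinearMap.toSpanSingleton_apply] at ht
        rw [LinearMap.comp_apply, LinearMap.comp_apply, ← ht, map_smul, hr, LinearMap.smul_apply,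
          map_smul, smul_comm]
      rw [this, LinearMap.smul_comp, map_smul, hs, LinearMap.smul_apply, map_smul]
    obtain ⟨m, rfl⟩ := N.mkQ_surjective c
    -- After subtracting evaluation at a lift of c, the form vanishes on everything that vanishes on
    -- N. Restriction to N is surjective because E is injective, so the form descends to the dual of
    -- N.
    let F' : (M →ₗ[R] E) →ₗ[R] E := F - LinearMap.applyₗ m
    let res : (M →ₗ[R] E) →ₗ[R] (N →ₗ[R] E) := LinearMap.lcomp R E N.subtype
    obtain ⟨G, hG⟩ := exists_comp_eq_of_ker_le (f := res) F' (fun ψ =>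
      Module.Injective.extension_property R E _ _ N.subtype N.injective_subtype ψ) (by
      intro φ hφ
      have hφ' : N ≤ LinearMap.ker φ := fun z hz => LinearMap.congr_fun hφ ⟨z, hz⟩
      have h1 := hc (N.liftQ φ hφ')
      rw [Submodule.liftQ_mkQ] at h1
      simp [F', h1])
    obtain ⟨n, hn⟩ := ih G
    refine ⟨n + m, fun φ => ?_⟩
    have h1 := LinearMap.congr_fun hG φ
    rw [LinearMap.comp_apply, hn] at h1
    have h2 : φ n = F φ - φ m := h1
    rw [map_add, h2, sub_add_cancel]

end Matlis

/-! ### Vanishing of Ext by dimension shifting. -/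

section Ext

variable {A : Type u} [Ring A] {X Y I Z : Type u} [AddCommGroup X] [Module A X]
  [AddCommGroup Y] [Module A Y] [AddCommGroup I] [Module A I] [AddCommGroup Z] [Module A Z]

theorem IsShortExact.comp_eq_zero {f : X →ₗ[A] Y} {g : Y →ₗ[A] Z} (h : IsShortExact f g) :
    g ∘ₗ f = 0 := h.2.1.linearMap_comp_eq_zero

/-- The short complex in the category of modules attached to a short exact sequence. -/
abbrev IsShortExact.shortComplex {f : X →ₗ[A] Y} {g : Y →ₗ[A] Z} (h : IsShortExact f g) :
    ShortComplex (ModuleCat.{u} A) :=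
  ShortComplex.mk (ModuleCat.ofHom f) (ModuleCat.ofHom g)
    (by rw [← ModuleCat.ofHom_comp, h.comp_eq_zero]; rfl)

theorem IsShortExact.shortExact {f : X →ₗ[A] Y} {g : Y →ₗ[A] Z} (h : IsShortExact f g) :
    h.shortComplex.ShortExact where
  exact := (ShortComplex.ShortExact.moduleCat_exact_iff_function_exact _).2 h.2.1
  mono_f := (ModuleCat.mono_iff_injective _).2 h.1
  epi_g := (ModuleCat.epi_iff_surjective _).2 h.2.2

theorem extVanish_zero (h : ∀ φ : X →ₗ[A] Y, φ = 0) : ExtVanish A X Y 0 := by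
  refine subsingleton_of_forall_eq 0 fun x => ?_
  obtain ⟨φ, rfl⟩ := Abelian.Ext.addEquiv₀.symm.surjective x
  have : φ = 0 := ModuleCat.hom_ext (h φ.hom)
  rw [this, map_zero]

theorem extVanish_of_projective [Module.Projective A X] (i : ℕ) : ExtVanish A X Y (i + 1) :=
  Abelian.Ext.subsingleton_of_projective _ _ _

/-- Since Ext^1(X, I) = 0, each class is the image of some φ : X → Z under the connecting map, which
kills the maps that lift to I. -/
theorem extVanish_one_of_injective [Module.Injective A I] {f : Y →ₗ[A] I} {g : I →ₗ[A] Z}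
    (h : IsShortExact f g) (hl : ∀ φ : X →ₗ[A] Z, ∃ ψ : X →ₗ[A] I, g ∘ₗ ψ = φ) :
    ExtVanish A X Y 1 := by
  have := Module.injective_object_of_injective_module A I
  refine subsingleton_of_forall_eq 0 fun x => ?_
  obtain ⟨y, rfl⟩ := Abelian.Ext.covariant_sequence_exact₁ _ h.shortExact x
    (Abelian.Ext.eq_zero_of_injective _) (zero_add 1)
  obtain ⟨φ, rfl⟩ := (Abelian.Ext.mk₀_bijective _ _).2 y
  obtain ⟨ψ, hψ⟩ := hl φ.hom
  have : φ = ModuleCat.ofHom ψ ≫ h.shortComplex.g := ModuleCat.hom_ext hψ.symm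
  rw [this, ← Abelian.Ext.mk₀_comp_mk₀, Abelian.Ext.comp_assoc_of_second_deg_zero,
    h.shortExact.comp_extClass, Abelian.Ext.comp_zero]

theorem extVanish_succ_of_injective [Module.Injective A I] {f : Y →ₗ[A] I} {g : I →ₗ[A] Z}
    (h : IsShortExact f g) {i : ℕ} (hi : ExtVanish A X Z i) : ExtVanish A X Y (i + 1) := by
  have := Module.injective_object_of_injective_module A I
  refine subsingleton_of_forall_eq 0 fun x => ?_
  obtain ⟨y, rfl⟩ := Abelian.Ext.covariant_sequence_exact₁ _ h.shortExact x
    (Abelian.Ext.eq_zero_of_injective _) rfl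
  have : y = 0 := hi.elim _ _
  rw [this, Abelian.Ext.zero_comp]

theorem extVanish_one_of_projective [Module.Projective A I] {f : Z →ₗ[A] I} {g : I →ₗ[A] X}
    (h : IsShortExact f g) (hl : ∀ φ : Z →ₗ[A] Y, ∃ ψ : I →ₗ[A] Y, ψ ∘ₗ f = φ) :
    ExtVanish A X Y 1 := by
  have := ModuleCat.projective_of_categoryTheory_projective (ModuleCat.of A I)
  refine subsingleton_of_forall_eq 0 fun x => ?_
  obtain ⟨y, rfl⟩ := Abelian.Ext.contravariant_sequence_exact₃ h.shortExact _ x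
    (Abelian.Ext.eq_zero_of_projective _) (add_zero 1)
  obtain ⟨φ, rfl⟩ := (Abelian.Ext.mk₀_bijective _ _).2 y
  obtain ⟨ψ, hψ⟩ := hl φ.hom
  have : φ = h.shortComplex.f ≫ ModuleCat.ofHom ψ := ModuleCat.hom_ext hψ.symm
  rw [this, ← Abelian.Ext.mk₀_comp_mk₀, h.shortExact.extClass_comp_assoc]

theorem extVanish_succ_of_projective [Module.Projective A I] {f : Z →ₗ[A] I} {g : I →ₗ[A] X}
    (h : IsShortExact f g) {i : ℕ} (hi : ExtVanish A Z Y i) : ExtVanish A X Y (i + 1) := by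
  have := ModuleCat.projective_of_categoryTheory_projective (ModuleCat.of A I)
  refine subsingleton_of_forall_eq 0 fun x => ?_
  obtain ⟨y, rfl⟩ := Abelian.Ext.contravariant_sequence_exact₃ h.shortExact _ x
    (Abelian.Ext.eq_zero_of_projective _) (add_comm 1 i)
  have : y = 0 := hi.elim _ _
  rw [this, Abelian.Ext.comp_zero]

end Ext

/-! ### The Jacobson radical, socles and Nakayama's lemma. -/

section Radical

/-- If no such element existed, multiplying by elements of rad Λ would produce nonzero elements
killed by ever lower powers of rad Λ, finally by Λ itself. -/
theorem exists_ne_zero_jacobson_smul_eq_zero {Λ : Type u} [Ring Λ]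
    (hΛ : IsNilpotent (Ring.jacobson Λ)) {M : Type u} [AddCommGroup M] [Module Λ M]
    {N : Submodule Λ M} (hN : N ≠ ⊥) :
    ∃ x ∈ N, x ≠ 0 ∧ ∀ a ∈ Ring.jacobson Λ, a • x = 0 := by
  obtain ⟨k, hk⟩ := hΛ
  by_contra! h
  have key : ∀ j : ℕ, ∃ x ∈ N, x ≠ 0 ∧ ∀ a ∈ Ring.jacobson Λ ^ (k - j), a • x = 0 := by
    intro j
    induction j with
    | zero =>
      obtain ⟨x, hx, hx0⟩ := Submodule.exists_mem_ne_zero_of_ne_bot hN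
      refine ⟨x, hx, hx0, fun a ha => ?_⟩
      rw [Nat.sub_zero, hk] at ha
      rw [show a = 0 from ha, zero_smul]
    | succ j ih =>
      obtain ⟨x, hx, hx0, hax⟩ := ih
      rcases Nat.eq_zero_or_pos (k - j) with h0 | h0
      · exact absurd (by simpa using hax 1 (by rw [h0, Submodule.pow_zero, Ideal.one_eq_top]; trivial)) hx0
      by_cases hc : ∀ a ∈ Ring.jacobson Λ ^ (k - (j + 1)), a • x = 0
      · exact ⟨x, hx, hx0, hc⟩
      push Not at hc
      obtain ⟨a, ha, hne⟩ := hc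
      exfalso
      obtain ⟨b, hb, hb'⟩ := h (a • x) (N.smul_mem a hx) hne
      refine hb' ?_
      rw [← mul_smul]
      refine hax _ ?_
      rw [show k - j = k - (j + 1) + 1 by omega, Ideal.IsTwoSided.pow_succ]
      exact Ideal.mul_mem_mul hb ha
  obtain ⟨x, -, hx0, hax⟩ := key k
  exact hx0 (by simpa using hax 1 (by rw [Nat.sub_self, Submodule.pow_zero, Ideal.one_eq_top]; trivial))

theorem eq_top_of_sup_eq_top_of_le_jacobson {Λ : Type u} [Ring Λ] {M : Type u} [AddCommGroup M]
    [Module Λ M] [Module.Finite Λ M] {N K : Submodule Λ M} (h : N ⊔ K = ⊤)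
    (hK : K ≤ Ring.jacobson Λ • (⊤ : Submodule Λ M)) : N = ⊤ := by
  by_contra hN
  obtain ⟨P, hP, hNP⟩ := (eq_top_or_exists_le_coatom N).resolve_left hN
  have h1 : K ≤ P := hK.trans ((Ring.jacobson_smul_top_le Λ M).trans (sInf_le hP))
  exact hP.1 (top_le_iff.1 (h ▸ sup_le hNP h1))

end Radical

/-! ### The Λ-modules Hom(V, Z) and Hom(Z, V), projective for summands Z of V. -/

section HomModules

variable {A : Type u} [Ring A] {V X Y Z W : Type u} [AddCommGroup V] [Module A V]
  [AddCommGroup X] [Module A X] [AddCommGroup Y] [Module A Y]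
  [AddCommGroup Z] [Module A Z] [AddCommGroup W] [Module A W]

/-- If `Z` is a retract of `V`, then every map `Hom(V, Z) → Hom(V, W)` is induced by a map
`Z → W`. -/
theorem exists_homMap_eq {i : Z →ₗ[A] V} {p : V →ₗ[A] Z} (h : p ∘ₗ i = LinearMap.id)
    (F : HomModule A V Z →ₗ[EndRing A V] HomModule A V W) :
    ∃ z : Z →ₗ[A] W, F = homMap V z := by
  refine ⟨(F p : V →ₗ[A] W) ∘ₗ i, LinearMap.ext fun (v : V →ₗ[A] Z) => ?_⟩
  have h1 : v = (MulOpposite.op (i ∘ₗ v : Module.End A V) • (show HomModule A V Z from p)) := by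
    change v = p ∘ₗ (i ∘ₗ v)
    rw [← LinearMap.comp_assoc, h, LinearMap.id_comp]
  conv_lhs => rw [h1]
  rw [map_smul]
  rfl

theorem homMap_comp (f : X →ₗ[A] Y) (g : Y →ₗ[A] Z) :
    homMap V (g ∘ₗ f) = homMap V g ∘ₗ homMap V f := rfl

theorem homMap_id : homMap V (LinearMap.id : X →ₗ[A] X) = LinearMap.id := rfl

/-- The regular module is `Hom(V, V)`. -/
def regularEquiv (A V : Type u) [Ring A] [AddCommGroup V] [Module A V] :
    EndRing A V ≃ₗ[EndRing A V] HomModule A V V where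
  toFun a := a.unop
  invFun h := MulOpposite.op h
  map_add' _ _ := rfl
  map_smul' _ _ := rfl
  left_inv _ := rfl
  right_inv _ := rfl

theorem homModule_retract {i : Z →ₗ[A] W} {p : W →ₗ[A] Z} (h : p ∘ₗ i = LinearMap.id) :
    homMap V p ∘ₗ homMap V i = LinearMap.id := by
  rw [← homMap_comp, h, homMap_id]

theorem homModule_projective (h : IsSummand A Z V) :
    Module.Projective (EndRing A V) (HomModule A V Z) := by
  obtain ⟨i, p, h⟩ := h
  have : Module.Projective (EndRing A V) (HomModule A V V) :=
    Module.Projective.of_equiv (regularEquiv A V)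
  exact Module.Projective.of_split _ _ (homModule_retract h)

theorem homModule_finite (h : IsSummand A Z V) :
    Module.Finite (EndRing A V) (HomModule A V Z) := by
  obtain ⟨i, p, h⟩ := h
  have : Module.Finite (EndRing A V) (HomModule A V V) :=
    Module.Finite.equiv (regularEquiv A V)
  exact Module.Finite.of_surjective (homMap V p)
    (Function.RightInverse.surjective (LinearMap.congr_fun (homModule_retract h)))

theorem homMap_surjective_of_lift {g : X →ₗ[A] Y}
    (h : ∀ φ : V →ₗ[A] Y, ∃ ψ : V →ₗ[A] X, g ∘ₗ ψ = φ) : Function.Surjective (homMap V g) :=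
  fun φ => h φ

/-- `Hom_A(V, -)` commutes with binary products. -/
def homModuleProd (A V X Y : Type u) [Ring A] [AddCommGroup V] [Module A V] [AddCommGroup X]
    [Module A X] [AddCommGroup Y] [Module A Y] :
    HomModule A V (X × Y) ≃ₗ[EndRing A V] HomModule A V X × HomModule A V Y where
  toFun h := (LinearMap.fst A X Y ∘ₗ h, LinearMap.snd A X Y ∘ₗ h)
  invFun h := LinearMap.prod h.1 h.2
  map_add' _ _ := rfl
  map_smul' _ _ := rfl
  left_inv _ := rfl
  right_inv _ := rfl

/-- `Hom_A(Z, V)` as a right module over the endomorphism ring of `V`. -/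
def CoHomModule (A V Z : Type u) [Ring A] [AddCommGroup V] [Module A V] [AddCommGroup Z]
    [Module A Z] : Type u :=
  Z →ₗ[A] V

instance : AddCommGroup (CoHomModule A V Z) := inferInstanceAs (AddCommGroup (Z →ₗ[A] V))

instance : Module (EndRing A V)ᵐᵒᵖ (CoHomModule A V Z) where
  smul a h := LinearMap.comp a.unop.unop (h : Z →ₗ[A] V)
  one_smul _ := rfl
  mul_smul _ _ _ := rfl
  smul_zero _ := LinearMap.comp_zero _
  smul_add _ _ _ := LinearMap.comp_add _ _ _
  add_smul a b h := LinearMap.add_comp (h : Z →ₗ[A] V) b.unop.unop a.unop.unop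
  zero_smul h := LinearMap.zero_comp (h : Z →ₗ[A] V)

/-- `Hom_A(g, V) : Hom_A(Y, V) → Hom_A(X, V)`. -/
def coHomMap (V : Type u) [AddCommGroup V] [Module A V] (g : X →ₗ[A] Y) :
    CoHomModule A V Y →ₗ[(EndRing A V)ᵐᵒᵖ] CoHomModule A V X where
  toFun h := LinearMap.comp (h : Y →ₗ[A] V) g
  map_add' _ _ := rfl
  map_smul' _ _ := rfl

/-- The right regular module is `Hom(V, V)`. -/
def coRegularEquiv (A V : Type u) [Ring A] [AddCommGroup V] [Module A V] :
    EndRing A V ≃ₗ[(EndRing A V)ᵐᵒᵖ] CoHomModule A V V where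
  toFun a := a.unop
  invFun h := MulOpposite.op h
  map_add' _ _ := rfl
  map_smul' _ _ := rfl
  left_inv _ := rfl
  right_inv _ := rfl

theorem coHomMap_retract {i : Z →ₗ[A] W} {p : W →ₗ[A] Z} (h : p ∘ₗ i = LinearMap.id) :
    coHomMap V i ∘ₗ coHomMap V p = LinearMap.id := by
  refine LinearMap.ext fun (f : Z →ₗ[A] V) => ?_
  change (f ∘ₗ p) ∘ₗ i = f
  rw [LinearMap.comp_assoc, h, LinearMap.comp_id]

theorem coHomModule_projective (h : IsSummand A Z V) :
    Module.Projective (EndRing A V)ᵐᵒᵖ (CoHomModule A V Z) := by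
  obtain ⟨i, p, h⟩ := h
  have : Module.Projective (EndRing A V)ᵐᵒᵖ (EndRing A V) :=
    Module.Projective.of_equiv (MulOpposite.opLinearEquiv (EndRing A V)ᵐᵒᵖ).symm
  have : Module.Projective (EndRing A V)ᵐᵒᵖ (CoHomModule A V V) :=
    Module.Projective.of_equiv (coRegularEquiv A V)
  exact Module.Projective.of_split _ _ (coHomMap_retract h)

/-- A linear map `Z → V` as an element of `Hom_A(Z, V)`. -/
def toCoHom (f : Z →ₗ[A] V) : CoHomModule A V Z := f

theorem coHomModule_eq_smul {i : Z →ₗ[A] V} {p : V →ₗ[A] Z} (h : p ∘ₗ i = LinearMap.id)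
    (f : CoHomModule A V Z) : f =
      MulOpposite.op (MulOpposite.op (LinearMap.comp (f : Z →ₗ[A] V) p : Module.End A V)) •
        toCoHom i := by
  revert f
  intro (f : Z →ₗ[A] V)
  change f = (f ∘ₗ p) ∘ₗ i
  rw [LinearMap.comp_assoc, h, LinearMap.comp_id]

theorem coHomModule_finite (h : IsSummand A Z V) :
    Module.Finite (EndRing A V)ᵐᵒᵖ (CoHomModule A V Z) := by
  obtain ⟨i, p, h⟩ := h
  refine ⟨⟨{toCoHom i}, ?_⟩⟩
  rw [eq_top_iff]
  intro f _
  rw [coHomModule_eq_smul h f, Finset.coe_singleton]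
  exact Submodule.smul_mem _ _ (Submodule.mem_span_singleton_self _)

/-- If `Z` is a retract of `V`, every right linear map `Hom(Z, V) → Λ` is given by precomposition
with a map `V → Z`. -/
theorem coHomModule_dual_apply {i : Z →ₗ[A] V} {p : V →ₗ[A] Z} (h : p ∘ₗ i = LinearMap.id)
    (F : CoHomModule A V Z →ₗ[(EndRing A V)ᵐᵒᵖ] EndRing A V) (f : Z →ₗ[A] V) :
    F (toCoHom f) = MulOpposite.op (f ∘ₗ p ∘ₗ (F (toCoHom i)).unop : Module.End A V) := by
  conv_lhs => rw [coHomModule_eq_smul h (toCoHom f), map_smul]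
  rfl

/-- The right linear map `Hom(Z, V) → Λ` given by precomposition with `z : V → Z`. -/
def coHomDual (z : V →ₗ[A] Z) : CoHomModule A V Z →ₗ[(EndRing A V)ᵐᵒᵖ] EndRing A V where
  toFun f := MulOpposite.op (LinearMap.comp (f : Z →ₗ[A] V) z : Module.End A V)
  map_add' _ _ := rfl
  map_smul' _ _ := rfl

/-- The right-module counterpart of `IsRadical.op_mem_jacobson`, needed for minimality of
presentations of right modules. -/
theorem IsRadical.op_op_mem_jacobson {h : X →ₗ[A] V}
    (hh : IsRadical h) (p : V →ₗ[A] X) :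
    MulOpposite.op (MulOpposite.op (h ∘ₗ p : Module.End A V)) ∈
      Ring.jacobson (EndRing A V)ᵐᵒᵖ := by
  rw [← Ideal.jacobson_bot, Ideal.mem_jacobson_iff]
  intro y
  obtain ⟨v, hv⟩ := ((hh.comp_left (y.unop.unop)).isUnit_one_sub (-p)).exists_left_inv
  refine ⟨MulOpposite.op (MulOpposite.op v), ?_⟩
  rw [Submodule.mem_bot, sub_eq_zero]
  apply MulOpposite.unop_injective
  apply MulOpposite.unop_injective
  rw [LinearMap.comp_neg, sub_neg_eq_add] at hv
  change (v * y.unop.unop) * (h ∘ₗ p) + v = 1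
  rw [← hv, mul_add, mul_one, mul_assoc, add_comm]
  rfl

/-- The range of `Hom(d, V)` is superfluous if `d` is radical. -/
theorem IsRadical.eq_top_of_sup_eq_top {d : Z →ₗ[A] W} (hd : IsRadical d) (hZ : IsSummand A Z V)
    {N K : Submodule (EndRing A V)ᵐᵒᵖ (CoHomModule A V Z)}
    (hK : ∀ f ∈ K, ∃ g : W →ₗ[A] V, (f : Z →ₗ[A] V) = g ∘ₗ d) (h : N ⊔ K = ⊤) :
    N = ⊤ := by
  have := coHomModule_finite hZ
  obtain ⟨i, p, hip⟩ := hZ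
  refine eq_top_of_sup_eq_top_of_le_jacobson h fun (f : Z →ₗ[A] V) hf => ?_
  obtain ⟨g, hg⟩ := hK f hf
  change toCoHom f ∈ _
  rw [coHomModule_eq_smul hip (toCoHom f)]
  refine Submodule.smul_mem_smul ?_ Submodule.mem_top
  change MulOpposite.op (MulOpposite.op (f ∘ₗ p : Module.End A V)) ∈ _
  have hg : f = g ∘ₗ d := hg
  rw [hg]
  exact (hd.comp_left g).op_op_mem_jacobson p

end HomModules

/-! ### The injective Λ-modules D Hom(Z, V). -/

section CoDual

variable (R A V E Z : Type u) [CommRing R] [Ring A] [Algebra R A]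
  [AddCommGroup V] [Module R V] [Module A V] [IsScalarTower R A V]
  [AddCommGroup E] [Module R E] [AddCommGroup Z] [Module A Z]

/-- The left module `D Hom_A(Z, V)` over the endomorphism ring of `V`. -/
def CoDual : Type u := (Z →ₗ[A] V) →ₗ[R] E

instance : AddCommGroup (CoDual R A V E Z) :=
  inferInstanceAs (AddCommGroup ((Z →ₗ[A] V) →ₗ[R] E))

variable {R A V E Z}

/-- Composition with an endomorphism, as an `R`-linear map. -/
def postComp (R : Type u) [CommRing R] [Algebra R A] [Module R V] [IsScalarTower R A V]
    (Z : Type u) [AddCommGroup Z] [Module A Z] (a : Module.End A V) :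
    (Z →ₗ[A] V) →ₗ[R] (Z →ₗ[A] V) where
  toFun f := a ∘ₗ f
  map_add' _ _ := LinearMap.comp_add _ _ _
  map_smul' r f := by ext; simp

/-- Composition with a linear map `Z → W`, as an `R`-linear map. -/
def preComp (R V : Type u) [CommRing R] [AddCommGroup V] [Algebra R A] [Module R V] [Module A V]
    [IsScalarTower R A V] {Z W : Type u} [AddCommGroup Z] [Module A Z] [AddCommGroup W]
    [Module A W] (d : Z →ₗ[A] W) : (W →ₗ[A] V) →ₗ[R] (Z →ₗ[A] V) where
  toFun f := f ∘ₗ d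
  map_add' _ _ := LinearMap.add_comp _ _ _
  map_smul' _ _ := LinearMap.smul_comp _ _ _

/-- The linear form on `Hom_A(Z, V)` given by an element of `D Hom_A(Z, V)`. -/
def CoDual.app (φ : CoDual R A V E Z) : (Z →ₗ[A] V) →ₗ[R] E := φ

/-- A linear form on `Hom_A(Z, V)` as an element of `D Hom_A(Z, V)`. -/
def CoDual.mk (φ : (Z →ₗ[A] V) →ₗ[R] E) : CoDual R A V E Z := φ

instance : Module (EndRing A V) (CoDual R A V E Z) where
  smul a φ := LinearMap.comp (φ : (Z →ₗ[A] V) →ₗ[R] E) (postComp R Z a.unop)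
  one_smul _ := rfl
  mul_smul _ _ _ := rfl
  smul_zero _ := LinearMap.zero_comp _
  smul_add _ _ _ := LinearMap.add_comp _ _ _
  add_smul a b φ := LinearMap.ext fun f =>
    (congrArg φ.app (LinearMap.add_comp f b.unop a.unop)).trans (map_add φ.app _ _)
  zero_smul φ := LinearMap.ext fun f =>
    (congrArg φ.app (LinearMap.zero_comp f)).trans (map_zero φ.app)

theorem CoDual.mk_app (φ : (Z →ₗ[A] V) →ₗ[R] E) (f : Z →ₗ[A] V) :
    (CoDual.mk φ).app f = φ f := rfl

theorem CoDual.ext {φ φ' : CoDual R A V E Z} (h : ∀ f, φ.app f = φ'.app f) : φ = φ' :=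
  LinearMap.ext (f := φ.app) (g := φ'.app) h

theorem CoDual.smul_app (a : EndRing A V) (φ : CoDual R A V E Z) (f : Z →ₗ[A] V) :
    (a • φ).app f = φ.app (a.unop ∘ₗ f) := rfl

theorem CoDual.add_app (φ φ' : CoDual R A V E Z) (f : Z →ₗ[A] V) :
    (φ + φ').app f = φ.app f + φ'.app f := rfl

theorem CoDual.zero_app (f : Z →ₗ[A] V) : (0 : CoDual R A V E Z).app f = 0 := rfl

theorem CoDual.app_eq {i : Z →ₗ[A] V} {p : V →ₗ[A] Z} (h : p ∘ₗ i = LinearMap.id)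
    (φ : CoDual R A V E Z) (f : Z →ₗ[A] V) :
    φ.app f = ((MulOpposite.op (f ∘ₗ p : Module.End A V)) • φ).app i := by
  rw [CoDual.smul_app, MulOpposite.unop_op, LinearMap.comp_assoc, h, LinearMap.comp_id]

theorem algebraMap_unop_comp (r : R) (f : Z →ₗ[A] V) :
    (algebraMap R (EndRing A V) r).unop ∘ₗ f = r • f := by
  ext; simp [MulOpposite.algebraMap_apply, Module.algebraMap_end_apply]

theorem CoDual.algebraMap_smul_app (r : R) (φ : CoDual R A V E Z) (f : Z →ₗ[A] V) :
    (algebraMap R (EndRing A V) r • φ).app f = r • φ.app f := by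
  rw [CoDual.smul_app, algebraMap_unop_comp, map_smul]

variable {W Y : Type u} [AddCommGroup W] [Module A W] [AddCommGroup Y] [Module A Y]

/-- The map `D Hom_A(Z, V) → D Hom_A(W, V)` induced by `d : Z → W`. -/
def coDualMap (R V E : Type u) [CommRing R] [Algebra R A] [AddCommGroup V] [Module R V]
    [Module A V] [IsScalarTower R A V] [AddCommGroup E] [Module R E] (d : Z →ₗ[A] W) :
    CoDual R A V E Z →ₗ[EndRing A V] CoDual R A V E W where
  toFun φ := CoDual.mk (φ.app ∘ₗ preComp R V d)
  map_add' _ _ := rfl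
  map_smul' _ _ := rfl

theorem coDualMap_app (d : Z →ₗ[A] W) (φ : CoDual R A V E Z) (f : W →ₗ[A] V) :
    (coDualMap R V E d φ).app f = φ.app (f ∘ₗ d) := rfl

theorem mem_ker_coDualMap {d : Z →ₗ[A] W} {φ : CoDual R A V E Z} :
    φ ∈ LinearMap.ker (coDualMap R V E d) ↔ ∀ f : W →ₗ[A] V, φ.app (f ∘ₗ d) = 0 :=
  ⟨fun h f => LinearMap.congr_fun (f := (coDualMap R V E d φ).app) h f, fun h => CoDual.ext h⟩

/-- By adjunction, Λ-linear maps into D Hom(Z, V) are determined by R-linear forms through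
evaluation at the inclusion i : Z → V. Such a form extends since `E` is injective, and an extension
l gives back the Λ-linear map y ↦ (ψ ↦ l((ψp) y)). -/
theorem coDual_injective (hE : Module.Injective R E) (hZ : IsSummand A Z V) :
    Module.Injective (EndRing A V) (CoDual R A V E Z) where
  out X Y _ _ _ _ f hf g := by
    obtain ⟨i, p, hip⟩ := hZ
    let _ := Module.compHom X (algebraMap R (EndRing A V))
    let _ := Module.compHom Y (algebraMap R (EndRing A V))
    let f₀ : X →ₗ[R] Y :=
      { toFun := f
        map_add' := f.map_add
        map_smul' := fun r x => f.map_smul (algebraMap R (EndRing A V) r) x }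
    let g₀ : X →ₗ[R] E :=
      { toFun := fun x => (g x).app i
        map_add' := fun x y => by rw [map_add]; rfl
        map_smul' := fun r x => by
          change (g (algebraMap R (EndRing A V) r • x)).app i = _
          rw [map_smul, CoDual.algebraMap_smul_app]
          rfl }
    obtain ⟨l, hl⟩ := hE.out f₀ hf g₀
    have key : ∀ (y : Y) (r : R) (a : EndRing A V),
        l ((algebraMap R (EndRing A V) r * a) • y) = r • l (a • y) := by
      intro y r a
      rw [← map_smul, mul_smul]
      rfl
    refine ⟨{ toFun := fun y => CoDual.mk
                { toFun := fun ψ => l (MulOpposite.op (ψ ∘ₗ p : Module.End A V) • y)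
                  map_add' := fun ψ ψ' => by
                    rw [LinearMap.add_comp, MulOpposite.op_add, add_smul, map_add]
                  map_smul' := fun r ψ => by
                    rw [RingHom.id_apply, ← key, ← Algebra.smul_def]
                    rfl }
              map_add' := fun y y' => CoDual.ext fun ψ => by
                rw [CoDual.mk_app, CoDual.add_app, CoDual.mk_app, CoDual.mk_app]
                simp only [LinearMap.coe_mk, AddHom.coe_mk]
                rw [smul_add, map_add]
              map_smul' := fun a y => CoDual.ext fun ψ => by
                rw [RingHom.id_apply, CoDual.smul_app, CoDual.mk_app, CoDual.mk_app]
                simp only [LinearMap.coe_mk, AddHom.coe_mk]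
                rw [← mul_smul]
                rfl }, fun x => CoDual.ext fun ψ => ?_⟩
    change l (MulOpposite.op (ψ ∘ₗ p : Module.End A V) • f x) = _
    rw [← map_smul]
    change l (f₀ _) = _
    rw [hl, CoDual.app_eq hip]
    change (g _).app i = _
    rw [map_smul]

theorem coDualMap_exact (hE : Module.Injective R E) {d : Z →ₗ[A] W} {d' : W →ₗ[A] Y}
    (h : Function.Exact (fun f : Y →ₗ[A] V => f ∘ₗ d') (fun f : W →ₗ[A] V => f ∘ₗ d)) :
    Function.Exact (coDualMap R V E d) (coDualMap R V E d') := by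
  intro φ
  constructor
  · intro hφ
    have hφ' := mem_ker_coDualMap.1 hφ
    have hker : LinearMap.ker (preComp R V d).rangeRestrict ≤ LinearMap.ker φ.app := by
      intro f hf
      have hf' : f ∘ₗ d = 0 := congrArg Subtype.val hf
      obtain ⟨f', hf'⟩ := (h f).1 hf'
      have : f' ∘ₗ d' = f := hf'
      rw [LinearMap.mem_ker, ← this, hφ']
    obtain ⟨k, hk⟩ := exists_comp_eq_of_ker_le φ.app (preComp R V d).surjective_rangeRestrict hker
    obtain ⟨ψ, hψ⟩ := Module.Injective.extension_property R E _ _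
      (LinearMap.range (preComp R V d)).subtype (Submodule.injective_subtype _) k
    refine ⟨CoDual.mk ψ, CoDual.ext fun f => ?_⟩
    rw [coDualMap_app, CoDual.mk_app, ← hk, ← hψ]
    rfl
  · rintro ⟨ψ, rfl⟩
    refine CoDual.ext fun f => ?_
    rw [coDualMap_app, coDualMap_app]
    have : (f ∘ₗ d') ∘ₗ d = 0 := (h (f ∘ₗ d')).2 ⟨f, rfl⟩
    rw [this, map_zero, CoDual.zero_app]

/-- The kernel of `D Hom(d, V)` is essential if `d` is radical. -/
theorem IsRadical.eq_bot_of_inf_ker_coDualMap (hΛ : IsNilpotent (Ring.jacobson (EndRing A V)))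
    {d : Z →ₗ[A] W} (hd : IsRadical d) (hZ : IsSummand A Z V)
    {N : Submodule (EndRing A V) (CoDual R A V E Z)}
    (hN : N ⊓ LinearMap.ker (coDualMap R V E d) = ⊥) : N = ⊥ := by
  obtain ⟨i, p, hip⟩ := hZ
  by_contra h
  obtain ⟨x, hx, hx0, hJ⟩ := exists_ne_zero_jacobson_smul_eq_zero hΛ h
  refine hx0 ((Submodule.mem_bot (EndRing A V)).1 (hN ▸ ⟨hx, mem_ker_coDualMap.2 fun f => ?_⟩))
  -- The value of x at fd is the value of (fdp)x at i, and fdp lies in rad Λ. So the kernel contains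
  -- every element killed by rad Λ.
  rw [CoDual.app_eq hip, hJ _ ((hd.comp_left f).op_mem_jacobson p), CoDual.zero_app]

section Duality

variable {ι : (R ⧸ Ring.jacobson R) →ₗ[R] E}

theorem endRing_finite [IsArtinianRing R] [Module.Finite R V] : Module.Finite R (EndRing A V) := by
  have h : Module.Finite R (Module.End A V) :=
    Module.Finite.of_injective (LinearMap.restrictScalarsₗ R A V V R)
      (LinearMap.restrictScalars_injective R)
  exact Module.Finite.equiv (MulOpposite.opLinearEquiv R)

theorem isFiniteLength_of_finite {R N : Type*} [CommRing R] [IsArtinianRing R] [AddCommGroup N]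
    [Module R N] [Module.Finite R N] : IsFiniteLength R N :=
  isFiniteLength_iff_isNoetherian_isArtinian.2 ⟨inferInstance, inferInstance⟩

theorem isNilpotent_jacobson_endRing [IsArtinianRing R] [Module.Finite R V] :
    IsNilpotent (Ring.jacobson (EndRing A V)) := by
  have := endRing_finite (R := R) (A := A) (V := V)
  have : IsArtinianRing (EndRing A V) := IsArtinianRing.of_finite R _
  exact IsSemiprimaryRing.isNilpotent

theorem hom_finite [IsArtinianRing R] [Module.Finite R V] (hZ : IsSummand A Z V) :
    Module.Finite R (Z →ₗ[A] V) := by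
  obtain ⟨i, p, h⟩ := hZ
  have h1 : Module.Finite R (Module.End A V) :=
    Module.Finite.of_injective (LinearMap.restrictScalarsₗ R A V V R)
      (LinearMap.restrictScalars_injective R)
  refine Module.Finite.of_surjective (preComp R V i) fun f => ⟨f ∘ₗ p, ?_⟩
  change (f ∘ₗ p) ∘ₗ i = f
  rw [LinearMap.comp_assoc, h, LinearMap.comp_id]

/-- The map `D(Λ) → D Hom_A(Z, V)` given by `z : V → Z`. -/
def dualRegularMap (R E : Type u) {V : Type u} [CommRing R] [Algebra R A] [AddCommGroup V] [Module R V]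
    [Module A V] [IsScalarTower R A V] [AddCommGroup E] [Module R E] (z : V →ₗ[A] Z) :
    DualRegular R (EndRing A V) E →ₗ[EndRing A V] CoDual R A V E Z where
  toFun x := CoDual.mk (LinearMap.comp (x : EndRing A V →ₗ[R] E)
    ((MulOpposite.opLinearEquiv R).toLinearMap ∘ₗ preComp R V z))
  map_add' _ _ := rfl
  map_smul' _ _ := rfl

/-- Fullness of the Nakayama functor: Hom(DΛ, D Hom(Z, V)) comes from Hom(V, Z). Evaluating F at i
gives a form on DΛ, which by reflexivity is evaluation at some a in Λ, and z is a followed by p. -/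
theorem exists_dualRegularMap_eq [IsArtinianRing R] [Module.Finite R V] (hι : IsInjEnvelope ι)
    (hZ : IsSummand A Z V)
    (F : DualRegular R (EndRing A V) E →ₗ[EndRing A V] CoDual R A V E Z) :
    ∃ z : V →ₗ[A] Z, F = dualRegularMap R E z := by
  obtain ⟨i, p, hip⟩ := hZ
  have := endRing_finite (R := R) (A := A) (V := V)
  obtain ⟨a, ha⟩ := hι.exists_eval_eq (N := EndRing A V) isFiniteLength_of_finite
    { toFun := fun x => (F x).app i
      map_add' := fun x y => congrArg (fun t => CoDual.app t i) (F.map_add x y)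
      map_smul' := fun r (x : DualRegular R (EndRing A V) E) => by
        let x' : EndRing A V →ₗ[R] E := x
        have h1 : algebraMap R (EndRing A V) r • x = r • x' := by
          refine LinearMap.ext fun y => ?_
          change x' (y * algebraMap R (EndRing A V) r) = r • x' y
          rw [← Algebra.commutes, ← Algebra.smul_def, map_smul]
        change CoDual.app (F (r • x')) i = _
        refine (congrArg (fun t => CoDual.app (F t) i) h1.symm).trans ?_
        refine (congrArg (fun t => CoDual.app t i)
          (F.map_smul (algebraMap R (EndRing A V) r) x)).trans ?_
        exact CoDual.algebraMap_smul_app _ _ _ }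
  refine ⟨p ∘ₗ a.unop, LinearMap.ext fun x => CoDual.ext fun f => ?_⟩
  rw [CoDual.app_eq hip, ← map_smul]
  exact ha (MulOpposite.op (f ∘ₗ p : Module.End A V) • x)

theorem coDualMap_dualRegularMap (z : V →ₗ[A] Z) (d : Z →ₗ[A] W) :
    coDualMap R V E d ∘ₗ dualRegularMap R E z = dualRegularMap R E (d ∘ₗ z) := rfl

theorem dualRegularMap_eq_zero [IsArtinianRing R] (hι : IsInjEnvelope ι)
    (hZ : IsSummand A Z V) {z : V →ₗ[A] Z} (h : dualRegularMap R E z = 0) : z = 0 := by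
  obtain ⟨i, p, hip⟩ := hZ
  have h1 : MulOpposite.op (i ∘ₗ z : Module.End A V) = 0 := by
    by_contra hne
    obtain ⟨x, hx⟩ := hι.exists_apply_ne_zero hne
    refine hx ?_
    exact LinearMap.congr_fun (f := CoDual.app (dualRegularMap R E z x))
      (congrArg CoDual.app (LinearMap.congr_fun h x)) i
  have h2 : i ∘ₗ z = 0 := congrArg MulOpposite.unop h1
  rw [← LinearMap.id_comp z, ← hip, LinearMap.comp_assoc, h2, LinearMap.comp_zero]

end Duality

end CoDual

/-! ### Hom(V, M) as the complement of the projective cover Hom(V, X). -/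

section ProjComplement

variable {A : Type u} [Ring A] {V X Y Z W M : Type u} [AddCommGroup V] [Module A V]
  [AddCommGroup X] [Module A X] [AddCommGroup Y] [Module A Y]
  [AddCommGroup Z] [Module A Z] [AddCommGroup W] [Module A W] [AddCommGroup M] [Module A M]

/-- A linear map `V → Z` as an element of `Hom_A(V, Z)`. -/
def toHom (f : V →ₗ[A] Z) : HomModule A V Z := f

theorem homMap_injective (hZ : IsSummand A Z V) {f g : Z →ₗ[A] W}
    (h : homMap V f = homMap V g) : f = g := by
  obtain ⟨i, p, hip⟩ := hZ
  have h1 : f ∘ₗ p = g ∘ₗ p := LinearMap.congr_fun h p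
  rw [← LinearMap.comp_id f, ← LinearMap.comp_id g, ← hip, ← LinearMap.comp_assoc, h1,
    LinearMap.comp_assoc]

theorem IsSummand.homModule (h : IsSummand A X Y) :
    IsSummand (EndRing A V) (HomModule A V X) (HomModule A V Y) := by
  obtain ⟨i, p, hip⟩ := h
  exact ⟨homMap V i, homMap V p, homModule_retract hip⟩

theorem IsSummand.of_homModule (hX : IsSummand A X V) (hY : IsSummand A Y V)
    (h : IsSummand (EndRing A V) (HomModule A V X) (HomModule A V Y)) : IsSummand A X Y := by
  obtain ⟨i, p, hip⟩ := h
  have ⟨a, hxi⟩ := hX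
  obtain ⟨b, hyp⟩ := hY
  obtain ⟨i, rfl⟩ := exists_homMap_eq hxi.choose_spec i
  obtain ⟨p, rfl⟩ := exists_homMap_eq hyp.choose_spec p
  exact ⟨i, p, homMap_injective hX hip⟩

theorem IsSummand.fin_pow_of_projective {Λ Q : Type u} [Ring Λ] [AddCommGroup Q] [Module Λ Q]
    [Module.Finite Λ Q] [Module.Projective Λ Q] : ∃ m : ℕ, IsSummand Λ Q (Fin m → Λ) := by
  obtain ⟨m, f, hf⟩ := Module.Finite.exists_fin' Λ Q
  obtain ⟨s, hs⟩ := Module.projective_lifting_property f LinearMap.id hf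
  exact ⟨m, s, f, hs⟩

theorem isProjComplement_homModule [IsNoetherianRing (EndRing A V)]
    [IsArtinianRing (EndRing A V)] [IsLocalRing (Module.End A X)] (e : V ≃ₗ[A] M × X)
    (hXM : ¬ IsSummand A X M) :
    IsProjComplement (EndRing A V) (HomModule A V M) (HomModule A V X) := by
  have hM : IsSummand A M V :=
    IsSummand.trans ⟨LinearMap.inl A M X, LinearMap.fst A M X, rfl⟩ (IsSummand.of_equiv e.symm)
  have hX : IsSummand A X V :=
    IsSummand.trans ⟨LinearMap.inr A M X, LinearMap.snd A M X, rfl⟩ (IsSummand.of_equiv e.symm)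
  refine ⟨homModule_finite hM, homModule_projective hM, fun Q _ _ hQ => ⟨?_, ?_⟩⟩
  · rintro h ⟨f⟩
    exact hXM (IsSummand.of_homModule hX hM ((IsSummand.of_equiv f.symm).trans h))
  · intro hne
    have := hQ.1
    have := hQ.isLocalRing_end
    obtain ⟨m, hm⟩ := IsSummand.fin_pow_of_projective (Λ := EndRing A V) (Q := Q)
    obtain ⟨-, h1⟩ := hm.exists_of_pi
    have h2 : IsSummand (EndRing A V) Q (HomModule A V M × HomModule A V X) :=
      ((h1.trans (IsSummand.of_equiv (regularEquiv A V))).trans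
        (IsSummand.of_equiv e).homModule).trans (IsSummand.of_equiv (homModuleProd A V M X))
    refine h2.or_of_prod.resolve_right fun h3 => hne ?_
    obtain ⟨i, p, hip⟩ := h3
    have ⟨a, hxi⟩ := hX
    -- The idempotent cutting Q out of Hom(V, X) comes from an idempotent c of the local ring
    -- End(X), so c is 1 or 0. In the first case Q ≅ Hom(V, X), in the second Q = 0.
    obtain ⟨c, hc⟩ := exists_homMap_eq hxi.choose_spec (i ∘ₗ p)
    have hcc : c * c = c := by
      apply homMap_injective hX
      change homMap V c ∘ₗ homMap V c = homMap V c
      rw [← hc]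
      exact LinearMap.ext fun y => congrArg i (LinearMap.congr_fun hip (p y))
    have hi : Function.Injective i := Function.LeftInverse.injective (LinearMap.congr_fun hip)
    rcases IsLocalRing.isUnit_or_isUnit_of_add_one (add_sub_cancel c 1) with h | h
    · have hc1 : c = 1 := by
        have := h.mul_left_cancel (hcc.trans (mul_one c).symm)
        exact this
      refine ⟨LinearEquiv.ofBijective i ⟨hi, fun y => ⟨p y, ?_⟩⟩⟩
      have := LinearMap.congr_fun hc y
      rw [hc1] at this
      exact this
    · exfalso
      have hc0 : c = 0 := by
        apply h.mul_left_cancel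
        rw [sub_mul, one_mul, hcc, sub_self, mul_zero]
      obtain ⟨x, hx⟩ := exists_ne (0 : Q)
      apply hx
      apply hi
      have h1 := LinearMap.congr_fun hc (i x)
      have h2 : p (i x) = x := LinearMap.congr_fun hip x
      rw [LinearMap.comp_apply, h2, hc0] at h1
      rw [h1, map_zero]
      exact LinearMap.zero_comp _

/-- Hom(V, X) is generated by p. If p = a + b with a in N and b in ker π, locality makes ai or bi a
unit, so a or b already generates; b cannot, since π ≠ 0. -/
theorem isProjCover_homModule [IsLocalRing (Module.End A X)] (hX : IsSummand A X V) {S : Type u}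
    [AddCommGroup S] [Module (EndRing A V) S] [IsSimpleModule (EndRing A V) S]
    {π : HomModule A V X →ₗ[EndRing A V] S} (hπ : π ≠ 0) : IsProjCover π := by
  refine ⟨homModule_projective hX, LinearMap.surjective_of_ne_zero hπ, fun N hN => ?_⟩
  obtain ⟨i, p, hip⟩ := hX
  have key : ∀ (K : Submodule (EndRing A V) (HomModule A V X)) (f : V →ₗ[A] X),
      toHom f ∈ K → IsUnit (f ∘ₗ i : Module.End A X) → K = ⊤ := by
    intro K f hf hu
    obtain ⟨v, hv⟩ := hu.exists_right_inv
    rw [eq_top_iff]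
    intro (h : V →ₗ[A] X) _
    have h1 := K.smul_mem (MulOpposite.op (i ∘ₗ v ∘ₗ h : Module.End A V)) hf
    change toHom h ∈ K
    have h2 : h = f ∘ₗ (i ∘ₗ v ∘ₗ h) := by
      rw [← LinearMap.comp_assoc, ← LinearMap.comp_assoc,
        show (f ∘ₗ i) ∘ₗ v = LinearMap.id from hv, LinearMap.id_comp]
    rw [h2]
    exact h1
  have hp : toHom p ∈ N ⊔ LinearMap.ker π := hN ▸ Submodule.mem_top
  obtain ⟨a, ha, b, hb, hab⟩ := Submodule.mem_sup.1 hp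
  revert a b
  intro (a : V →ₗ[A] X) ha (b : V →ₗ[A] X) hb hab
  have hab : a + b = p := hab
  have h1 : (a ∘ₗ i : Module.End A X) + b ∘ₗ i = 1 := by
    rw [← LinearMap.add_comp, hab, hip]; rfl
  rcases IsLocalRing.isUnit_or_isUnit_of_add_one h1 with h | h
  · exact key N a ha h
  · exact absurd (LinearMap.ker_eq_top.1 (key _ b hb h)) hπ

end ProjComplement

/-! ### The simple module S as the kernel of D Hom(d, V). -/

section Socle

variable {R A : Type u} [CommRing R] [Ring A] [Algebra R A]
  {V E X Z W Y : Type u}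
  [AddCommGroup V] [Module R V] [Module A V] [IsScalarTower R A V]
  [AddCommGroup E] [Module R E] [AddCommGroup X] [Module A X] [AddCommGroup Z] [Module A Z]
  [AddCommGroup W] [Module A W] [AddCommGroup Y] [Module A Y]
  {ι : (R ⧸ Ring.jacobson R) →ₗ[R] E}

/-- The inclusion i does not factor through the radical map `d`, and `E` cogenerates, so some form
on the cokernel of Hom(d, V) detects i. -/
theorem exists_mem_ker_coDualMap_app_ne_zero [IsArtinianRing R] (hι : IsInjEnvelope ι) [Nontrivial X] {d : X →ₗ[A] W}
    (hd : IsRadical d) {i : X →ₗ[A] V} {p : V →ₗ[A] X} (hip : p ∘ₗ i = LinearMap.id) :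
    ∃ s ∈ LinearMap.ker (coDualMap R V E d), s.app i ≠ 0 := by
  have hi : (LinearMap.range (preComp R V d)).mkQ i ≠ 0 := by
    rw [Submodule.mkQ_apply, Ne, Submodule.Quotient.mk_eq_zero]
    rintro ⟨f, hf⟩
    have hf : f ∘ₗ d = i := hf
    exact hd.no_retraction (p ∘ₗ f) (by rw [LinearMap.comp_assoc, hf, hip])
  obtain ⟨φ, hφ⟩ := hι.exists_apply_ne_zero hi
  refine ⟨CoDual.mk (φ ∘ₗ (LinearMap.range (preComp R V d)).mkQ),
    mem_ker_coDualMap.2 fun f => ?_, hφ⟩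
  have : (LinearMap.range (preComp R V d)).mkQ (f ∘ₗ d) = 0 := by
    rw [Submodule.mkQ_apply, Submodule.Quotient.mk_eq_zero]
    exact ⟨f, rfl⟩
  rw [CoDual.mk_app, LinearMap.comp_apply, this, map_zero]

/-- The kernel consists of the forms that vanish on radical maps X → V. If s were not in Λx,
reflexivity would give f : X → V annihilated by Λx with s(f) ≠ 0. Such an f is not radical, so it
has a retraction r, and x(g) = ((gr)x)(f) = 0 for every g, contradicting x ≠ 0. -/
theorem isSimpleModule_ker_coDualMap [IsArtinianRing R] [Module.Finite R V] (hι : IsInjEnvelope ι)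
    [IsLocalRing (Module.End A X)] [Nontrivial X] {d : X →ₗ[A] W}
    (hd : IsRadical d) (hX : IsSummand A X V)
    (hfac : ∀ f : X →ₗ[A] V, IsRadical f → ∃ g : W →ₗ[A] V, g ∘ₗ d = f) :
    IsSimpleModule (EndRing A V) (LinearMap.ker (coDualMap R V E d)) := by
  rw [isSimpleModule_iff_toSpanSingleton_surjective]
  obtain ⟨i, p, hip⟩ := hX
  constructor
  · obtain ⟨s, hs, hs0⟩ := exists_mem_ker_coDualMap_app_ne_zero (E := E) hι hd hip
    refine ⟨⟨s, hs⟩, 0, fun h => hs0 ?_⟩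
    have h1 : s = 0 := congrArg Subtype.val h
    rw [h1, CoDual.zero_app]
  rintro ⟨x, hx⟩ hx0 ⟨s, hs⟩
  have hx0 : x ≠ 0 := fun h => hx0 (Subtype.ext h)
  suffices h : s ∈ (EndRing A V) ∙ x by
    obtain ⟨a, ha⟩ := Submodule.mem_span_singleton.1 h
    exact ⟨a, Subtype.ext ha⟩
  by_contra hsx
  let U : Submodule R ((X →ₗ[A] V) →ₗ[R] E) :=
    { carrier := {φ | CoDual.mk φ ∈ (EndRing A V) ∙ x}
      add_mem' := fun ha hb => ((EndRing A V) ∙ x).add_mem ha hb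
      zero_mem' := ((EndRing A V) ∙ x).zero_mem
      smul_mem' := fun r φ hφ => by
        have h := ((EndRing A V) ∙ x).smul_mem (x := CoDual.mk φ) (algebraMap R (EndRing A V) r) hφ
        have h' : algebraMap R (EndRing A V) r • CoDual.mk φ = CoDual.mk (r • φ) :=
          CoDual.ext fun f => CoDual.algebraMap_smul_app _ _ _
        rw [h'] at h
        exact h }
  have hsU : U.mkQ s.app ≠ 0 := by
    rw [Submodule.mkQ_apply, Ne, Submodule.Quotient.mk_eq_zero]
    exact hsx
  obtain ⟨χ, hχ⟩ := hι.exists_apply_ne_zero hsU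
  have := hom_finite (R := R) (A := A) (V := V) (Z := X) ⟨i, p, hip⟩
  obtain ⟨f, hf⟩ := hι.exists_eval_eq (N := X →ₗ[A] V) isFiniteLength_of_finite (χ ∘ₗ U.mkQ)
  have hfU : ∀ a : EndRing A V, (a • x).app f = 0 := by
    intro a
    rw [← hf (a • x).app, LinearMap.comp_apply, Submodule.mkQ_apply,
      (Submodule.Quotient.mk_eq_zero U).2, map_zero]
    exact Submodule.smul_mem _ a (Submodule.mem_span_singleton_self x)
  have hfs : s.app f ≠ 0 := by rw [← hf]; exact hχ
  have hfr : ¬ IsRadical f := fun h => by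
    obtain ⟨g, rfl⟩ := hfac f h
    exact hfs (mem_ker_coDualMap.1 hs g)
  obtain ⟨r, hr⟩ := exists_retraction_of_not_isRadical hfr
  refine hx0 (CoDual.ext fun g => ?_)
  have h1 := hfU (MulOpposite.op (g ∘ₗ r : Module.End A V))
  rw [CoDual.smul_app, MulOpposite.unop_op, LinearMap.comp_assoc, hr, LinearMap.comp_id] at h1
  rw [h1, CoDual.zero_app]

theorem exists_isProjCover_ker_coDualMap [IsArtinianRing R] [Module.Finite R V] (hι : IsInjEnvelope ι)
    [IsLocalRing (Module.End A X)] [Nontrivial X] {d : X →ₗ[A] W}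
    (hd : IsRadical d) (hX : IsSummand A X V)
    (hfac : ∀ f : X →ₗ[A] V, IsRadical f → ∃ g : W →ₗ[A] V, g ∘ₗ d = f) :
    ∃ π : HomModule A V X →ₗ[EndRing A V] LinearMap.ker (coDualMap R V E d), IsProjCover π := by
  have := isSimpleModule_ker_coDualMap (E := E) hι hd hX hfac
  have ⟨i, p, hip⟩ := hX
  obtain ⟨s, hs, hs0⟩ := exists_mem_ker_coDualMap_app_ne_zero (E := E) hι hd hip
  refine ⟨LinearMap.toSpanSingleton (EndRing A V) _
    (⟨s, hs⟩ : LinearMap.ker (coDualMap R V E d)) ∘ₗ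
      (regularEquiv A V).symm.toLinearMap ∘ₗ homMap V i, isProjCover_homModule hX fun h => hs0 ?_⟩
  have h1 := LinearMap.congr_fun h p
  have h2 : MulOpposite.op (i ∘ₗ p : Module.End A V) • s = 0 := congrArg Subtype.val h1
  rw [CoDual.app_eq hip, h2, CoDual.zero_app]

/-- Endomorphisms fp of V that factor through Z annihilate the kernel: fpg is radical for each g : X
→ V, so it factors through `d`. A form in D Hom(Z, V) is determined by the action of these
endomorphisms. -/
theorem hom_ker_coDualMap_eq_zero {d : X →ₗ[A] W}
    (hfac : ∀ f : X →ₗ[A] V, IsRadical f → ∃ g : W →ₗ[A] V, g ∘ₗ d = f)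
    (hXZ : ∀ u : X →ₗ[A] Z, IsRadical u) (hZ : IsSummand A Z V)
    (F : LinearMap.ker (coDualMap R V E d) →ₗ[EndRing A V] CoDual R A V E Z) : F = 0 := by
  obtain ⟨i, p, hip⟩ := hZ
  refine LinearMap.ext fun s => CoDual.ext fun f => ?_
  have h : MulOpposite.op (f ∘ₗ p : Module.End A V) • s = 0 := by
    refine Subtype.ext (CoDual.ext fun g => ?_)
    change (MulOpposite.op (f ∘ₗ p : Module.End A V) • s.1).app g = 0
    rw [CoDual.smul_app, MulOpposite.unop_op, LinearMap.comp_assoc]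
    obtain ⟨k, hk⟩ := hfac _ ((hXZ (p ∘ₗ g)).comp_left f)
    rw [← hk]
    exact mem_ker_coDualMap.1 s.2 k
  rw [CoDual.app_eq hip, ← map_smul, h, map_zero]
  rfl

theorem isShortExact_ker_coDualMap {d : Z →ₗ[A] W} {d' : W →ₗ[A] Y}
    (h : Function.Exact (coDualMap R V E d) (coDualMap R V E d')) :
    IsShortExact (LinearMap.ker (coDualMap R V E d)).subtype
      ((coDualMap R V E d).codRestrict (LinearMap.ker (coDualMap R V E d'))
        fun x => LinearMap.mem_ker.2 (h.apply_apply_eq_zero x)) := by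
  refine ⟨Subtype.val_injective, fun x => ?_, fun y => ?_⟩
  · exact ⟨fun hx => ⟨⟨x, congrArg Subtype.val hx⟩, rfl⟩, by
      rintro ⟨y, rfl⟩
      exact Subtype.ext y.2⟩
  · obtain ⟨x, hx⟩ := (h y.1).1 y.2
    exact ⟨x, Subtype.ext hx⟩

theorem isInjEnvelope_ker_coDualMap [IsArtinianRing R] [Module.Finite R V] (hE : Module.Injective R E)
    {d : Z →ₗ[A] W} (hd : IsRadical d) (hZ : IsSummand A Z V) :
    IsInjEnvelope (LinearMap.ker (coDualMap R V E d)).subtype :=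
  ⟨coDual_injective hE hZ, Subtype.val_injective, fun N hN => by
    rw [Submodule.range_subtype] at hN
    exact hd.eq_bot_of_inf_ker_coDualMap (isNilpotent_jacobson_endRing (R := R)) hZ hN⟩

end Socle

/-! ### The minimal presentation of D(K) and its transpose. -/

section Transpose

variable {R A : Type u} [CommRing R] [Ring A] [Algebra R A]
  {V E Z W Y : Type u}
  [AddCommGroup V] [Module R V] [Module A V] [IsScalarTower R A V]
  [AddCommGroup E] [Module R E] [AddCommGroup Z] [Module A Z]
  [AddCommGroup W] [Module A W] [AddCommGroup Y] [Module A Y]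
  {ι : (R ⧸ Ring.jacobson R) →ₗ[R] E}

/-- The inclusion of the kernel of `D Hom_A(Z, V) → D Hom_A(W, V)`, as an `R`-linear map. -/
def kerInclusion (R V E : Type u) [CommRing R] [Algebra R A] [AddCommGroup V] [Module R V]
    [Module A V] [IsScalarTower R A V] [AddCommGroup E] [Module R E] (d : Z →ₗ[A] W) :
    RestrictScalars R (EndRing A V) (LinearMap.ker (coDualMap R V E d)) →ₗ[R]
      ((Z →ₗ[A] V) →ₗ[R] E) where
  toFun φ := CoDual.app ((LinearMap.ker (coDualMap R V E d)).subtype φ)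
  map_add' _ _ := rfl
  map_smul' r _ := LinearMap.ext fun _ => CoDual.algebraMap_smul_app r _ _

/-- Evaluation at `f : Z → V`, as a linear form on the kernel of
`D Hom_A(Z, V) → D Hom_A(W, V)`. -/
def evalForm (R V E : Type u) [CommRing R] [Algebra R A] [AddCommGroup V] [Module R V] [Module A V]
    [IsScalarTower R A V] [AddCommGroup E] [Module R E] (d : Z →ₗ[A] W) (f : Z →ₗ[A] V) :
    RestrictScalars R (EndRing A V) (LinearMap.ker (coDualMap R V E d)) →ₗ[R] E :=
  LinearMap.applyₗ f ∘ₗ kerInclusion R V E d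

/-- The evaluation map `Hom_A(Z, V) → D(K)`, where `K` is the kernel of
`D Hom_A(Z, V) → D Hom_A(W, V)`. -/
def evalKer (R V E : Type u) [CommRing R] [Algebra R A] [AddCommGroup V] [Module R V] [Module A V]
    [IsScalarTower R A V] [AddCommGroup E] [Module R E] (d : Z →ₗ[A] W) :
    CoHomModule A V Z →ₗ[(EndRing A V)ᵐᵒᵖ]
      DualOfLeft R (EndRing A V) E (LinearMap.ker (coDualMap R V E d)) where
  toFun f := evalForm R V E d f
  map_add' f g := LinearMap.ext fun φ => (kerInclusion R V E d φ).map_add f g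
  map_smul' _ _ := rfl

/-- A form on the kernel extends to D Hom(Z, V) because `E` is injective, and there it is an
evaluation by reflexivity. -/
theorem evalKer_surjective [IsArtinianRing R] [Module.Finite R V] (hι : IsInjEnvelope ι)
    (d : Z →ₗ[A] W) (hZ : IsSummand A Z V) : Function.Surjective (evalKer R V E d) := by
  intro G
  let _ : Module R (LinearMap.ker (coDualMap R V E d)) :=
    Module.compHom _ (algebraMap R (EndRing A V))
  let incl : LinearMap.ker (coDualMap R V E d) →ₗ[R] ((Z →ₗ[A] V) →ₗ[R] E) :=
    kerInclusion R V E d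
  let G' : LinearMap.ker (coDualMap R V E d) →ₗ[R] E := G
  have := hι.1
  have := hom_finite (R := R) hZ
  obtain ⟨F, hF⟩ := Module.Injective.extension_property R E _ _ incl
    (fun a b h => Subtype.ext h) G'
  obtain ⟨f, hf⟩ := hι.exists_eval_eq (N := Z →ₗ[A] V) isFiniteLength_of_finite F
  refine ⟨f, LinearMap.ext fun φ => ?_⟩
  exact (hf _).symm.trans (LinearMap.congr_fun hF φ)

theorem mem_ker_evalKer [IsArtinianRing R] (hι : IsInjEnvelope ι)
    (d : Z →ₗ[A] W) (f : Z →ₗ[A] V) :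
    toCoHom f ∈ LinearMap.ker (evalKer R V E d) ↔ ∃ g : W →ₗ[A] V, g ∘ₗ d = f := by
  constructor
  · intro hf
    by_contra h
    have hne : (LinearMap.range (preComp R V d)).mkQ f ≠ 0 := by
      rw [Submodule.mkQ_apply, Ne, Submodule.Quotient.mk_eq_zero]
      exact h
    obtain ⟨φ, hφ⟩ := hι.exists_apply_ne_zero hne
    let s : CoDual R A V E Z := CoDual.mk (φ ∘ₗ (LinearMap.range (preComp R V d)).mkQ)
    have hs : s ∈ LinearMap.ker (coDualMap R V E d) := mem_ker_coDualMap.2 fun g => by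
      have : (LinearMap.range (preComp R V d)).mkQ (g ∘ₗ d) = 0 := by
        rw [Submodule.mkQ_apply, Submodule.Quotient.mk_eq_zero]
        exact ⟨g, rfl⟩
      rw [CoDual.mk_app, LinearMap.comp_apply, this, map_zero]
    let s' : RestrictScalars R (EndRing A V) (LinearMap.ker (coDualMap R V E d)) :=
      (⟨s, hs⟩ : LinearMap.ker (coDualMap R V E d))
    exact hφ (LinearMap.congr_fun hf s')
  · rintro ⟨g, rfl⟩
    exact LinearMap.ext fun φ =>
      mem_ker_coDualMap.1 (Subtype.property (p := (· ∈ LinearMap.ker (coDualMap R V E d))) φ) g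

theorem isProjCover_evalKer [IsArtinianRing R] [Module.Finite R V] (hι : IsInjEnvelope ι)
    {d : Z →ₗ[A] W} (hd : IsRadical d) (hZ : IsSummand A Z V) :
    IsProjCover (evalKer R V E d) := by
  refine ⟨coHomModule_projective hZ, evalKer_surjective hι d hZ, fun N hN =>
    hd.eq_top_of_sup_eq_top hZ (fun f hf => ?_) hN⟩
  obtain ⟨g, hg⟩ := (mem_ker_evalKer hι d f).1 hf
  exact ⟨g, hg.symm⟩

/-- If `Z` is a retract of `V`, the `Λ`-dual of `Hom_A(Z, V)` is `Hom_A(V, Z)`. -/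
def coHomDualEquiv {i : Z →ₗ[A] V} {p : V →ₗ[A] Z} (h : p ∘ₗ i = LinearMap.id) :
    (CoHomModule A V Z →ₗ[(EndRing A V)ᵐᵒᵖ] EndRing A V) ≃ₗ[EndRing A V] HomModule A V Z where
  toFun F := p ∘ₗ (F (toCoHom i)).unop
  invFun z := coHomDual z
  map_add' F G := LinearMap.comp_add _ _ _
  map_smul' a F := rfl
  left_inv F := LinearMap.ext fun f => (coHomModule_dual_apply h F f).symm
  right_inv := fun (z : V →ₗ[A] Z) => by
    change p ∘ₗ (i ∘ₗ z) = z
    rw [← LinearMap.comp_assoc, h, LinearMap.id_comp]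

/-- Hom(W, V) → Hom(Z, V) presents D(K). It is minimal because the kernels of both covers consist of
maps factoring through `d`, respectively `g`, which are radical. Dualizing into Λ gives Hom(V, Z) →
Hom(V, W), and exactness of Hom(V, -) identifies its cokernel with the image of Hom(V, g). -/
theorem isTranspose_dual_ker_coDualMap [IsArtinianRing R] [Module.Finite R V]
    (hι : IsInjEnvelope ι) {d : Z →ₗ[A] W} {g : W →ₗ[A] Y} (hd : IsRadical d) (hg : IsRadical g)
    (hZ : IsSummand A Z V) (hW : IsSummand A W V)
    (hto : Function.Exact (fun f : Y →ₗ[A] V => f ∘ₗ g) (fun f : W →ₗ[A] V => f ∘ₗ d))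
    (hfrom : Function.Exact (fun f : V →ₗ[A] Z => d ∘ₗ f) (fun f : V →ₗ[A] W => g ∘ₗ f)) :
    IsTranspose (EndRing A V) (DualOfLeft R (EndRing A V) E (LinearMap.ker (coDualMap R V E d)))
      (LinearMap.range (homMap V g)) := by
  have hmem : ∀ x, coHomMap V d x ∈ LinearMap.ker (evalKer R V E d) := fun x =>
    (mem_ker_evalKer hι d _).2 ⟨x, rfl⟩
  refine ⟨ModuleCat.of _ (CoHomModule A V W), ModuleCat.of _ (CoHomModule A V Z), coHomMap V d,
    evalKer R V E d, hmem, isProjCover_evalKer hι hd hZ,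
    ⟨coHomModule_projective hW, fun ⟨f, hf⟩ => ?_, fun N hN => ?_⟩, ?_⟩
  · obtain ⟨h, hh⟩ := (mem_ker_evalKer hι d f).1 hf
    exact ⟨h, Subtype.ext hh⟩
  · refine hg.eq_top_of_sup_eq_top hW (fun f hf => ?_) hN
    obtain ⟨h, hh⟩ := (hto f).1 (congrArg Subtype.val hf)
    exact ⟨h, hh.symm⟩
  · obtain ⟨i, p, hip⟩ := hW
    refine ⟨(homMap V g).rangeRestrict ∘ₗ (coHomDualEquiv hip).toLinearMap, fun F => ?_,
      (homMap V g).surjective_rangeRestrict.comp (coHomDualEquiv hip).surjective⟩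
    obtain ⟨z, rfl⟩ := (coHomDualEquiv hip).symm.surjective F
    revert z
    intro (z : V →ₗ[A] W)
    rw [LinearMap.comp_apply]
    have h1 : (coHomDualEquiv hip).toLinearMap ((coHomDualEquiv hip).symm z) = z :=
      (coHomDualEquiv hip).apply_symm_apply z
    rw [h1]
    constructor
    · intro h
      obtain ⟨y, hy⟩ := (hfrom z).1 (congrArg Subtype.val h)
      refine ⟨coHomDual y, LinearMap.ext fun (f : W →ₗ[A] V) => ?_⟩
      change MulOpposite.op ((f ∘ₗ d) ∘ₗ y : Module.End A V) = MulOpposite.op (f ∘ₗ z)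
      rw [← hy]
      rfl
    · rintro ⟨F, hF⟩
      obtain ⟨j, q, hjq⟩ := hZ
      obtain ⟨y, rfl⟩ := (coHomDualEquiv hjq).symm.surjective F
      revert y
      intro (y : V →ₗ[A] Z) hF
      have h2 : MulOpposite.op ((i ∘ₗ d) ∘ₗ y : Module.End A V) =
        MulOpposite.op (i ∘ₗ z : Module.End A V) := LinearMap.congr_fun hF (toCoHom i)
      have h3 : i ∘ₗ (d ∘ₗ y) = i ∘ₗ z := congrArg MulOpposite.unop h2
      have h4 : d ∘ₗ y = z := by
        have := congrArg (fun t => p ∘ₗ t) h3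
        simpa only [← LinearMap.comp_assoc, hip, LinearMap.id_comp] using this
      exact Subtype.ext ((hfrom z).2 ⟨y, h4⟩)

end Transpose

/-! ### The n-BB-tilting criterion for sequences. -/

section Sequence

variable {R A : Type u} [CommRing R] [Ring A] [Algebra R A]
  {V E M : Type u} [AddCommGroup V] [Module R V] [Module A V]
  [IsScalarTower R A V] [AddCommGroup E] [Module R E] [AddCommGroup M] [Module A M]
  {ι : (R ⧸ Ring.jacobson R) →ₗ[R] E}
  {N : ℕ → Type u} [∀ i, AddCommGroup (N i)] [∀ i, Module A (N i)]
  {n : ℕ} {d : ∀ i, N (i + 1) →ₗ[A] N i}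

theorem isCosyzygy_ker_coDualMap [IsArtinianRing R] [Module.Finite R V]
    (hE : Module.Injective R E)
    (hN : ∀ i, i ≤ n → IsSummand A (N (i + 1)) V) (hrad : ∀ i, i ≤ n → IsRadical (d i))
    (hto : ∀ i, i < n → Function.Exact (fun h : N i →ₗ[A] V => h ∘ₗ d i)
      (fun h : N (i + 1) →ₗ[A] V => h ∘ₗ d (i + 1))) (m : ℕ) (hm : m + 1 ≤ n) :
    IsCosyzygy m (ModuleCat.of (EndRing A V) (LinearMap.ker (coDualMap R V E (d (m + 1)))))
      (ModuleCat.of (EndRing A V) (LinearMap.ker (coDualMap R V E (d 1)))) := by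
  induction m with
  | zero => exact ⟨LinearEquiv.refl _ _⟩
  | succ m ih =>
    exact ⟨ModuleCat.of _ (CoDual R A V E (N (m + 3))), _, _, _,
      isInjEnvelope_ker_coDualMap hE (hrad _ hm) (hN _ hm),
      isShortExact_ker_coDualMap (coDualMap_exact hE (hto (m + 1) (by omega))), ih (by omega)⟩

/-- With S = K_n, shifting gives Ext^{i+1}(S, K_j) as a quotient of Hom(S, K_{j-i-1}), which embeds
in Hom(S, I(N_{j-i})) = 0. The induction needs arbitrary j; only j = n is used in the end. -/
theorem extVanish_ker_coDualMap_self (hE : Module.Injective R E)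
    (hN : ∀ i, i ≤ n → IsSummand A (N (i + 1)) V)
    (hto : ∀ i, i < n → Function.Exact (fun h : N i →ₗ[A] V => h ∘ₗ d i)
      (fun h : N (i + 1) →ₗ[A] V => h ∘ₗ d (i + 1)))
    (hfac : ∀ f : N (n + 1) →ₗ[A] V, IsRadical f → ∃ g : N n →ₗ[A] V, g ∘ₗ d n = f)
    (hX : ∀ i, i < n → ∀ u : N (n + 1) →ₗ[A] N (i + 1), IsRadical u)
    (i j : ℕ) (hij : i + 1 ≤ j) (hj : j ≤ n) :
    ExtVanish (EndRing A V) (LinearMap.ker (coDualMap R V E (d n)))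
      (LinearMap.ker (coDualMap R V E (d j))) (i + 1) := by
  obtain ⟨j, rfl⟩ := Nat.exists_eq_add_of_le' (Nat.le_of_add_left_le hij)
  have := coDual_injective hE (hN (j + 1) hj)
  have hse := isShortExact_ker_coDualMap (coDualMap_exact hE (hto j (by omega)))
  induction i generalizing j with
  | zero =>
    refine extVanish_one_of_injective hse fun φ => ⟨0, ?_⟩
    have h := hom_ker_coDualMap_eq_zero hfac (hX j (by omega)) (hN j (by omega))
      ((LinearMap.ker (coDualMap R V E (d j))).subtype ∘ₗ φ)
    refine LinearMap.ext fun x => Subtype.ext ?_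
    exact (LinearMap.congr_fun h x).symm
  | succ i ih =>
    obtain ⟨j, rfl⟩ := Nat.exists_eq_add_of_le' (show 1 ≤ j by omega)
    exact extVanish_succ_of_injective hse (ih j (by omega) (by omega)
      (coDual_injective hE (hN (j + 1) (by omega)))
      (isShortExact_ker_coDualMap (coDualMap_exact hE (hto j (by omega)))))

/-- A map DΛ → K_n corresponds to z : V → N_{n+1} with d_n z = 0. The correspondence is faithful at
N_n because n ≥ 1 makes N_n a summand of V. -/
theorem extVanish_dualRegular_zero [IsArtinianRing R] [Module.Finite R V]
    (hι : IsInjEnvelope ι)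
    (hN : ∀ i, i ≤ n → IsSummand A (N (i + 1)) V) (hn : 1 ≤ n)
    (hinj : Function.Injective (d n)) :
    ExtVanish (EndRing A V) (DualRegular R (EndRing A V) E)
      (LinearMap.ker (coDualMap R V E (d n))) 0 := by
  refine extVanish_zero fun φ => ?_
  obtain ⟨z, hz⟩ := exists_dualRegularMap_eq hι (hN n le_rfl)
    ((LinearMap.ker (coDualMap R V E (d n))).subtype ∘ₗ φ)
  have h : dualRegularMap R E (d n ∘ₗ z) = 0 := by
    rw [← coDualMap_dualRegularMap, ← hz]
    exact LinearMap.ext fun x => (φ x).2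
  obtain ⟨m, rfl⟩ := Nat.exists_eq_add_of_le' hn
  have h1 := dualRegularMap_eq_zero hι (hN m (by omega)) h
  have h2 : z = 0 := by
    ext v
    exact hinj (by simpa using LinearMap.congr_fun h1 v)
  rw [h2] at hz
  exact LinearMap.ext fun x => Subtype.ext
    ((LinearMap.congr_fun hz x).trans (CoDual.ext fun f => by
      let x' : EndRing A V →ₗ[R] E := x
      change x' (MulOpposite.op (f ∘ₗ (0 : V →ₗ[A] _))) = 0
      rw [LinearMap.comp_zero, MulOpposite.op_zero, map_zero]))

theorem extVanish_dualRegular_succ [IsArtinianRing R] [Module.Finite R V]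
    (hι : IsInjEnvelope ι)
    (hN : ∀ i, i ≤ n → IsSummand A (N (i + 1)) V)
    (hto : ∀ i, i < n → Function.Exact (fun h : N i →ₗ[A] V => h ∘ₗ d i)
      (fun h : N (i + 1) →ₗ[A] V => h ∘ₗ d (i + 1)))
    (hfrom : ∀ i, i < n → Function.Exact (fun h : V →ₗ[A] N (i + 2) => d (i + 1) ∘ₗ h)
      (fun h : V →ₗ[A] N (i + 1) => d i ∘ₗ h))
    (i j : ℕ) (hij : i + 1 < j) (hj : j ≤ n) :
    ExtVanish (EndRing A V) (DualRegular R (EndRing A V) E)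
      (LinearMap.ker (coDualMap R V E (d j))) (i + 1) := by
  obtain ⟨j, rfl⟩ := Nat.exists_eq_add_of_le' (show 2 ≤ j by omega)
  have := coDual_injective hι.1 (hN (j + 2) hj)
  have hse := isShortExact_ker_coDualMap (coDualMap_exact hι.1 (hto (j + 1) (by omega)))
  induction i generalizing j with
  | zero =>
    refine extVanish_one_of_injective hse fun φ => ?_
    obtain ⟨z, hz⟩ := exists_dualRegularMap_eq hι (hN (j + 1) (by omega))
      ((LinearMap.ker (coDualMap R V E (d (j + 1)))).subtype ∘ₗ φ)
    have h : dualRegularMap R E (d (j + 1) ∘ₗ z) = 0 := by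
      rw [← coDualMap_dualRegularMap, ← hz]
      exact LinearMap.ext fun x => (φ x).2
    -- A map DΛ → K_{j+1} is a z : V → N_{j+2} killed by d_{j+1}, so it lifts to y : V → N_{j+3}.
    -- The bound i + 1 < j keeps the target of d_{j+1} away from N_0, which need not be a summand of
    -- V.
    obtain ⟨y, hy⟩ := (hfrom (j + 1) (by omega) z).1
      (dualRegularMap_eq_zero hι (hN j (by omega)) h)
    refine ⟨dualRegularMap R E y, LinearMap.ext fun x => Subtype.ext ?_⟩
    have h1 := LinearMap.congr_fun hz x
    rw [← hy] at h1
    exact h1.symm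
  | succ i ih =>
    obtain ⟨j, rfl⟩ := Nat.exists_eq_add_of_le' (show 1 ≤ j by omega)
    exact extVanish_succ_of_injective hse (ih j (by omega) (by omega)
      (coDual_injective hι.1 (hN (j + 2) (by omega)))
      (isShortExact_ker_coDualMap (coDualMap_exact hι.1 (hto (j + 1) (by omega)))))

/-- A sequence `0 → N (n+1) → ⋯ → N 1 → N 0` of radical maps which is exact under `Hom(V, -)` and
`Hom(-, V)`, and whose left end is a source map for `V`, gives an `n`-BB-tilting module over the
endomorphism ring of `V`. -/
theorem isNBBTilting_of_sequence [IsArtinianRing R] [Module.Finite R V]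
    {T : Type u} [AddCommGroup T] [Module (EndRing A V) T]
    (hn : 1 ≤ n) [IsLocalRing (Module.End A (N (n + 1)))] (hnt : Nontrivial (N (n + 1)))
    (hN : ∀ i, i ≤ n → IsSummand A (N (i + 1)) V) (hrad : ∀ i, i ≤ n → IsRadical (d i))
    (hinj : Function.Injective (d n))
    (hto : ∀ i, i < n → Function.Exact (fun h : N i →ₗ[A] V => h ∘ₗ d i)
      (fun h : N (i + 1) →ₗ[A] V => h ∘ₗ d (i + 1)))
    (hfrom : ∀ i, i < n → Function.Exact (fun h : V →ₗ[A] N (i + 2) => d (i + 1) ∘ₗ h)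
      (fun h : V →ₗ[A] N (i + 1) => d i ∘ₗ h))
    (hfac : ∀ f : N (n + 1) →ₗ[A] V, IsRadical f → ∃ g : N n →ₗ[A] V, g ∘ₗ d n = f)
    (e : V ≃ₗ[A] M × N (n + 1)) (hM : ¬ IsSummand A (N (n + 1)) M)
    (hNM : ∀ i, i < n → IsSummand A (N (i + 1)) M)
    (eT : T ≃ₗ[EndRing A V] LinearMap.range (homMap V (d 0)) × HomModule A V M) :
    IsNBBTilting R (EndRing A V) n T := by
  obtain ⟨E, ι, hι⟩ := exists_isInjEnvelope (R := R) (R ⧸ Ring.jacobson R)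
  have hX : ∀ i, i < n → ∀ u : N (n + 1) →ₗ[A] N (i + 1), IsRadical u := by
    intro i hi u
    by_contra hu
    obtain ⟨r, hr⟩ := exists_retraction_of_not_isRadical hu
    exact hM (IsSummand.trans ⟨u, r, hr⟩ (hNM i hi))
  have := endRing_finite (R := R) (A := A) (V := V)
  have : IsArtinianRing (EndRing A V) := IsArtinianRing.of_finite R _
  obtain ⟨π, hπ⟩ := exists_isProjCover_ker_coDualMap (R := R) (E := E) hι (hrad n le_rfl)
    (hN n le_rfl) hfac
  refine ⟨hn, E, ι, hι, ModuleCat.of _ (LinearMap.ker (coDualMap R V E (d n))),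
    isSimpleModule_ker_coDualMap hι (hrad n le_rfl) (hN n le_rfl) hfac, fun j hj => ?_,
    fun i hi hin => ?_, ModuleCat.of _ (LinearMap.ker (coDualMap R V E (d 1))),
    ModuleCat.of _ (LinearMap.range (homMap V (d 0))), ModuleCat.of _ (HomModule A V (N (n + 1))),
    ModuleCat.of _ (HomModule A V M), π, ?_,
    isTranspose_dual_ker_coDualMap hι (hrad 1 hn) (hrad 0 (by omega)) (hN 1 hn) (hN 0 (by omega))
      (hto 0 hn) (hfrom 0 hn), hπ, isProjComplement_homModule e hM, ⟨eT⟩⟩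
  · cases j with
    | zero => exact extVanish_dualRegular_zero hι hN hn hinj
    | succ j => exact extVanish_dualRegular_succ hι hN hto hfrom j n hj le_rfl
  · obtain ⟨i, rfl⟩ := Nat.exists_eq_add_of_le' hi
    exact extVanish_ker_coDualMap_self hι.1 hN hto hfac hX i n hin le_rfl
  · obtain ⟨m, rfl⟩ := Nat.exists_eq_add_of_le' hn
    exact isCosyzygy_ker_coDualMap hι.1 hN hrad hto m le_rfl

end Sequence

/-! ### Exactness of Hom for products, and the n-almost split case. -/

section ProductExactness

variable {A : Type u} [Ring A] {X Y Z P Q : Type u} [AddCommGroup X] [Module A X]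
  [AddCommGroup Y] [Module A Y] [AddCommGroup Z] [Module A Z] [AddCommGroup P] [Module A P]
  [AddCommGroup Q] [Module A Q] {d' : X →ₗ[A] Y} {d : Y →ₗ[A] Z}

theorem exact_postcomp_prod
    (hP : Function.Exact (fun h : P →ₗ[A] X => d' ∘ₗ h) (fun h : P →ₗ[A] Y => d ∘ₗ h))
    (hQ : Function.Exact (fun h : Q →ₗ[A] X => d' ∘ₗ h) (fun h : Q →ₗ[A] Y => d ∘ₗ h)) :
    Function.Exact (fun h : P × Q →ₗ[A] X => d' ∘ₗ h) (fun h : P × Q →ₗ[A] Y => d ∘ₗ h) := by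
  intro h
  constructor
  · intro h0
    have h0 : d ∘ₗ h = 0 := h0
    obtain ⟨a, ha⟩ := (hP (h ∘ₗ LinearMap.inl A P Q)).1 (by
      beta_reduce; rw [← LinearMap.comp_assoc, h0, LinearMap.zero_comp])
    obtain ⟨b, hb⟩ := (hQ (h ∘ₗ LinearMap.inr A P Q)).1 (by
      beta_reduce; rw [← LinearMap.comp_assoc, h0, LinearMap.zero_comp])
    refine ⟨a.coprod b, LinearMap.prod_ext ?_ ?_⟩
    · rw [← ha, LinearMap.comp_assoc, LinearMap.coprod_inl]
    · rw [← hb, LinearMap.comp_assoc, LinearMap.coprod_inr]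
  · rintro ⟨k, rfl⟩
    refine LinearMap.prod_ext ?_ ?_
    · exact (hP _).2 ⟨k ∘ₗ LinearMap.inl A P Q, rfl⟩
    · exact (hQ _).2 ⟨k ∘ₗ LinearMap.inr A P Q, rfl⟩

theorem exact_precomp_prod
    (hP : Function.Exact (fun h : Z →ₗ[A] P => h ∘ₗ d) (fun h : Y →ₗ[A] P => h ∘ₗ d'))
    (hQ : Function.Exact (fun h : Z →ₗ[A] Q => h ∘ₗ d) (fun h : Y →ₗ[A] Q => h ∘ₗ d')) :
    Function.Exact (fun h : Z →ₗ[A] P × Q => h ∘ₗ d) (fun h : Y →ₗ[A] P × Q => h ∘ₗ d') := by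
  intro h
  constructor
  · intro h0
    have h0 : h ∘ₗ d' = 0 := h0
    obtain ⟨a, ha⟩ := (hP (LinearMap.fst A P Q ∘ₗ h)).1 (by
      beta_reduce; rw [LinearMap.comp_assoc, h0, LinearMap.comp_zero])
    obtain ⟨b, hb⟩ := (hQ (LinearMap.snd A P Q ∘ₗ h)).1 (by
      beta_reduce; rw [LinearMap.comp_assoc, h0, LinearMap.comp_zero])
    exact ⟨a.prod b, LinearMap.ext fun y =>
      Prod.ext (LinearMap.congr_fun ha y) (LinearMap.congr_fun hb y)⟩
  · rintro ⟨k, rfl⟩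
    have h1 := (hP _).2 ⟨LinearMap.fst A P Q ∘ₗ k, rfl⟩
    have h2 := (hQ _).2 ⟨LinearMap.snd A P Q ∘ₗ k, rfl⟩
    exact LinearMap.ext fun y =>
      Prod.ext (LinearMap.congr_fun h1 y) (LinearMap.congr_fun h2 y)

variable {ι : Type} {S : ι → Type u} [∀ i, AddCommGroup (S i)]
  [∀ i, Module A (S i)]

theorem exact_postcomp_pi [Fintype ι] [DecidableEq ι]
    (hS : ∀ i, Function.Exact (fun h : S i →ₗ[A] X => d' ∘ₗ h)
      (fun h : S i →ₗ[A] Y => d ∘ₗ h)) :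
    Function.Exact (fun h : (Π i, S i) →ₗ[A] X => d' ∘ₗ h)
      (fun h : (Π i, S i) →ₗ[A] Y => d ∘ₗ h) := by
  intro h
  constructor
  · intro h0
    have h0 : d ∘ₗ h = 0 := h0
    choose a ha using fun i => (hS i (h ∘ₗ LinearMap.single A S i)).1 (by
      beta_reduce; rw [← LinearMap.comp_assoc, h0, LinearMap.zero_comp])
    refine ⟨LinearMap.lsum A S ℕ a, LinearMap.pi_ext' fun i => ?_⟩
    rw [← ha, LinearMap.comp_assoc]
    congr 1
    ext x
    apply LinearMap.lsum_piSingle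
  · rintro ⟨k, rfl⟩
    exact LinearMap.pi_ext' fun i => (hS i _).2 ⟨k ∘ₗ LinearMap.single A S i, rfl⟩

theorem exact_precomp_pi
    (hS : ∀ i, Function.Exact (fun h : Z →ₗ[A] S i => h ∘ₗ d)
      (fun h : Y →ₗ[A] S i => h ∘ₗ d')) :
    Function.Exact (fun h : Z →ₗ[A] (Π i, S i) => h ∘ₗ d)
      (fun h : Y →ₗ[A] (Π i, S i) => h ∘ₗ d') := by
  intro h
  constructor
  · intro h0
    have h0 : h ∘ₗ d' = 0 := h0
    choose a ha using fun i => (hS i (LinearMap.proj i ∘ₗ h)).1 (by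
      beta_reduce; rw [LinearMap.comp_assoc, h0, LinearMap.comp_zero])
    exact ⟨LinearMap.pi a, LinearMap.ext fun y => funext fun i => LinearMap.congr_fun (ha i) y⟩
  · rintro ⟨k, rfl⟩
    exact LinearMap.ext fun y => funext fun i =>
      LinearMap.congr_fun ((hS i _).2 ⟨LinearMap.proj i ∘ₗ k, rfl⟩) y

theorem isSummand_inl : IsSummand A P (P × Q) := ⟨LinearMap.inl A P Q, LinearMap.fst A P Q, rfl⟩

theorem isSummand_inr : IsSummand A Q (P × Q) := ⟨LinearMap.inr A P Q, LinearMap.snd A P Q, rfl⟩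

end ProductExactness

/-- An `n`-almost split sequence in a maximal orthogonal subcategory gives an `n`-BB-tilting
module. -/
theorem isNBBTilting_of_isNAlmostSplit {n : ℕ} (hn : 1 ≤ n) (k A : Type u) [Field k] [Ring A]
    [Algebra k A] [Module.Finite k A] (C : ObjectProperty (ModuleCat.{u} A)) (N : ℕ → Type u)
    [∀ i, AddCommGroup (N i)] [∀ i, Module k (N i)] [∀ i, Module A (N i)]
    [∀ i, IsScalarTower k A (N i)] (d : ∀ i, N (i + 1) →ₗ[A] N i)
    (hC : ∀ X, C X → Module.Finite A X) (hX : IsIndec A (N (n + 1)))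
    (hd : IsNAlmostSplit C n d) (hadd : ¬ InAdd A (N (n + 1)) (Π i : Fin n, N (i + 1))) :
    IsNBBTilting k (EndRing A ((Π i : Fin n, N (i + 1)) × N (n + 1))) n
      (HomModule A ((Π i : Fin n, N (i + 1)) × N (n + 1)) (Π i : Fin n, N (i + 1)) ×
        LinearMap.range (homMap ((Π i : Fin n, N (i + 1)) × N (n + 1)) (d 0))) := by
  have hfinA : ∀ i, i ≤ n + 1 → Module.Finite A (N i) := fun i hi => hC _ (hd.mem i hi)
  have hfin : ∀ i, i ≤ n + 1 → Module.Finite k (N i) := fun i hi =>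
    have := hfinA i hi
    Module.Finite.trans A (N i)
  have : ∀ i : Fin n, Module.Finite k (N (i + 1)) := fun i => hfin _ (by omega)
  have := hfin (n + 1) le_rfl
  have := hfinA (n + 1) le_rfl
  have : IsArtinianRing A := IsArtinianRing.of_finite k A
  have := hX.isLocalRing_end
  have hNM : ∀ i, i < n → IsSummand A (N (i + 1)) (Π i : Fin n, N (i + 1)) := fun i hi =>
    isSummand_pi (Y := fun i : Fin n => N (i + 1)) ⟨i, hi⟩
  refine isNBBTilting_of_sequence (d := d) hn hX.1 (fun i hi => ?_) hd.radical hd.injective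
    (fun i hi => ?_) (fun i hi => ?_) (fun f hf => ?_) (LinearEquiv.refl A _)
    (fun h => hadd h.inAdd) hNM (LinearEquiv.prodComm _ _ _)
  · rcases hi.lt_or_eq with h | rfl
    · exact (hNM i h).trans isSummand_inl
    · exact isSummand_inr
  · exact exact_precomp_prod
      (exact_precomp_pi fun j => hd.hom_to_exact _ (hd.mem (j + 1) (by omega)) i hi)
      (hd.hom_to_exact _ (hd.mem (n + 1) le_rfl) i hi)
  · exact exact_postcomp_prod
      (exact_postcomp_pi fun j => hd.hom_from_exact _ (hd.mem (j + 1) (by omega)) i hi)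
      (hd.hom_from_exact _ (hd.mem (n + 1) le_rfl) i hi)
  · choose a ha using fun j : Fin n => (hd.hom_to_radical _ (hd.mem (j + 1) (by omega))
      (LinearMap.proj j ∘ₗ LinearMap.fst A _ _ ∘ₗ f)).1 ((hf.comp_left _).comp_left _)
    obtain ⟨b, hb⟩ := (hd.hom_to_radical _ (hd.mem (n + 1) le_rfl)
      (LinearMap.snd A _ _ ∘ₗ f)).1 (hf.comp_left _)
    refine ⟨(LinearMap.pi a).prod b, LinearMap.ext fun x => Prod.ext ?_ ?_⟩
    · exact funext fun j => LinearMap.congr_fun (ha j) x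
    · exact LinearMap.congr_fun hb x

/-! ### Auslander–Reiten sequences. -/

section ARSequence

variable {A : Type u} [Ring A] {U M W U' M' Y V Z : Type u} [AddCommGroup U] [Module A U]
  [AddCommGroup M] [Module A M] [AddCommGroup W] [Module A W] [AddCommGroup U'] [Module A U']
  [AddCommGroup M'] [Module A M'] [AddCommGroup Y] [Module A Y] [AddCommGroup V] [Module A V]
  [AddCommGroup Z] [Module A Z]
  {f : U →ₗ[A] M} {g : M →ₗ[A] W} {f' : U' →ₗ[A] M'} {g' : M' →ₗ[A] Y}

theorem IsARSequence.no_retraction (h : IsARSequence f g) :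
    ¬ ∃ r : M →ₗ[A] U, r ∘ₗ f = LinearMap.id := by
  rintro ⟨r, hr⟩
  have hr' : ∀ x, r (f x) = x := LinearMap.congr_fun hr
  have hfg : ∀ x, g (f x) = 0 := h.shortExact.2.1.apply_apply_eq_zero
  obtain ⟨s, hs⟩ := exists_comp_eq_of_ker_le (LinearMap.id - f ∘ₗ r) h.shortExact.2.2 (by
    intro y hy
    obtain ⟨x, rfl⟩ := (h.shortExact.2.1 y).1 hy
    simp [hr'])
  refine h.not_split ⟨s, LinearMap.ext fun w => ?_⟩
  obtain ⟨y, rfl⟩ := h.shortExact.2.2 w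
  have h1 : s (g y) = y - f (r y) := LinearMap.congr_fun hs y
  rw [LinearMap.comp_apply, h1, map_sub, hfg, sub_zero]
  rfl

theorem IsARSequence.isRadical_left [IsLocalRing (Module.End A U)] (h : IsARSequence f g) :
    IsRadical f :=
  isRadical_of_no_retraction h.no_retraction

theorem IsARSequence.isRadical_right [IsLocalRing (Module.End A W)] (h : IsARSequence f g) :
    IsRadical g :=
  isRadical_of_no_section h.not_split

theorem IsARSequence.exists_lift (h : IsARSequence f g) [Module.Finite A V]
    (hV : ¬ IsSummand A W V) (u : V →ₗ[A] W) : ∃ v : V →ₗ[A] M, g ∘ₗ v = u :=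
  h.right_almost_split (ModuleCat.of A V) ‹_› u fun ⟨s, hs⟩ => hV ⟨s, u, hs⟩

theorem IsARSequence.exists_extension (h : IsARSequence f g) [Module.Finite A V]
    (hV : ¬ IsSummand A U V) (u : U →ₗ[A] V) : ∃ v : M →ₗ[A] V, v ∘ₗ f = u :=
  h.left_almost_split (ModuleCat.of A V) ‹_› u fun ⟨r, hr⟩ => hV ⟨u, r, hr⟩

/-- If `Y` is a direct summand of the middle term of the Auslander-Reiten sequence starting in `U`,
then `U` is a direct summand of the middle term of the one ending in `Y`. -/
theorem IsARSequence.isSummand_middle [IsLocalRing (Module.End A Y)] (h : IsARSequence f g)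
    (h' : IsARSequence f' g') (hY : IsSummand A Y M) : IsSummand A U M' := by
  obtain ⟨s, r, hrs⟩ := hY
  have := h.finite_left
  have := h'.finite_middle
  have := h.indec_left.1
  have := h'.indec_right.1
  by_contra hU
  -- A split epimorphism from the indecomposable U would be an isomorphism, and then f would split.
  have h1 : ¬ ∃ t : Y →ₗ[A] U, (r ∘ₗ f) ∘ₗ t = LinearMap.id := by
    rintro ⟨t, ht⟩
    have hb := (h.indec_left.bijective_of_retraction ht).2
    obtain ⟨k, hk⟩ : ∃ k : Y →ₗ[A] U, k ∘ₗ (r ∘ₗ f) = LinearMap.id :=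
      ⟨(LinearEquiv.ofBijective _ hb).symm, LinearMap.ext fun x =>
        (LinearEquiv.ofBijective _ hb).symm_apply_apply x⟩
    exact h.no_retraction ⟨k ∘ₗ r, hk⟩
  obtain ⟨v, hv⟩ := h'.right_almost_split (ModuleCat.of A U) ‹_› (r ∘ₗ f) h1
  obtain ⟨w, hw⟩ := h.exists_extension hU v
  -- Both r and g'w restrict to rf along f, so their difference factors through g. Composing with s
  -- writes 1 as g'ws + kgs in the local ring End(Y): the first being a unit splits g', the second
  -- makes gs an isomorphism and splits g.
  obtain ⟨k, hk⟩ := exists_comp_eq_of_ker_le (r - g' ∘ₗ w) h.shortExact.2.2 (by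
    intro y hy
    obtain ⟨x, rfl⟩ := (h.shortExact.2.1 y).1 hy
    have e1 : g' (v x) = r (f x) := LinearMap.congr_fun hv x
    have e2 : w (f x) = v x := LinearMap.congr_fun hw x
    simp [e1, e2])
  have hsum : (g' ∘ₗ (w ∘ₗ s) : Module.End A Y) + k ∘ₗ (g ∘ₗ s) = 1 := by
    have e : k ∘ₗ (g ∘ₗ s) = (k ∘ₗ g) ∘ₗ s := rfl
    rw [e, hk, LinearMap.sub_comp, hrs, LinearMap.comp_assoc, add_sub_cancel]
    rfl
  rcases IsLocalRing.isUnit_or_isUnit_of_add_one hsum with hu | hu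
  · obtain ⟨t, ht⟩ := hu.exists_right_inv
    exact h'.not_split ⟨(w ∘ₗ s) ∘ₗ t, by rw [← LinearMap.comp_assoc]; exact ht⟩
  · obtain ⟨t, ht⟩ := hu.exists_left_inv
    have hb := (h.indec_right.bijective_of_retraction (i := g ∘ₗ s) (p := t ∘ₗ k) (by
      rw [LinearMap.comp_assoc]; exact ht)).1
    refine h.not_split ⟨s ∘ₗ (LinearEquiv.ofBijective _ hb).symm, LinearMap.ext fun x => ?_⟩
    exact (LinearEquiv.ofBijective _ hb).apply_symm_apply x

theorem IsShortExact.homMap {f : U →ₗ[A] M} {g : M →ₗ[A] W} (h : IsShortExact f g)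
    (hl : ∀ u : V →ₗ[A] W, ∃ v : V →ₗ[A] M, g ∘ₗ v = u) :
    IsShortExact (homMap V f) (homMap V g) := by
  refine ⟨fun (a : V →ₗ[A] U) (b : V →ₗ[A] U) hab => ?_, fun (u : V →ₗ[A] M) => ⟨fun hu => ?_, ?_⟩,
    homMap_surjective_of_lift hl⟩
  · exact LinearMap.ext fun x => h.1 (LinearMap.congr_fun (f := f ∘ₗ a) (g := f ∘ₗ b) hab x)
  · have hu : g ∘ₗ u = 0 := hu
    have hmem : ∀ x, u x ∈ LinearMap.range f := fun x => (h.2.1 _).1 (LinearMap.congr_fun hu x)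
    refine ⟨toHom ((LinearEquiv.ofInjective f h.1).symm.toLinearMap ∘ₗ u.codRestrict _ hmem),
      LinearMap.ext fun x => ?_⟩
    exact congrArg Subtype.val
      ((LinearEquiv.ofInjective f h.1).apply_symm_apply (u.codRestrict _ hmem x))
  · rintro ⟨v, rfl⟩
    change (g ∘ₗ f) ∘ₗ (show V →ₗ[A] U from v) = 0
    rw [h.comp_eq_zero, LinearMap.zero_comp]

end ARSequence

/-! ### Adding summands to resolutions and coresolutions. -/

section Resolutions

variable {Λ : Type u} [Ring Λ]

theorem IsShortExact.prod_right {U M W Z : Type u} [AddCommGroup U] [Module Λ U] [AddCommGroup M]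
    [Module Λ M] [AddCommGroup W] [Module Λ W] [AddCommGroup Z] [Module Λ Z] {f : U →ₗ[Λ] M}
    {g : M →ₗ[Λ] W} (h : IsShortExact f g) :
    IsShortExact (LinearMap.inl Λ M Z ∘ₗ f) (g.prodMap (LinearMap.id : Z →ₗ[Λ] Z)) := by
  refine ⟨LinearMap.inl_injective.comp h.1, fun ⟨x, y⟩ => ⟨fun hxy => ?_, ?_⟩, fun ⟨x, y⟩ => ?_⟩
  · have hx : g x = 0 := congrArg Prod.fst hxy
    have hy : y = 0 := congrArg Prod.snd hxy
    obtain ⟨k, rfl⟩ := (h.2.1 x).1 hx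
    exact ⟨k, Prod.ext rfl hy.symm⟩
  · rintro ⟨k, hk⟩
    rw [← hk]
    exact Prod.ext (h.2.1.apply_apply_eq_zero k) rfl
  · obtain ⟨x, rfl⟩ := h.2.2 x
    exact ⟨(x, y), rfl⟩

theorem HasProjRes.prod {m : ℕ} {X : ModuleCat.{u} Λ} (h : HasProjRes m X) (P : Type u)
    [AddCommGroup P] [Module Λ P] [Module.Finite Λ P] [Module.Projective Λ P] :
    HasProjRes m (ModuleCat.of Λ (X × P)) := by
  cases m with
  | zero =>
    have := h.1
    have := h.2
    exact ⟨inferInstanceAs (Module.Finite Λ (X × P)), inferInstanceAs (Module.Projective Λ (X × P))⟩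
  | succ m =>
    obtain ⟨K, P₀, i, p, hf, hp, hse, hK⟩ := h
    exact ⟨K, ModuleCat.of Λ (P₀ × P), LinearMap.inl Λ P₀ P ∘ₗ i, p.prodMap LinearMap.id,
      inferInstanceAs (Module.Finite Λ (P₀ × P)), inferInstanceAs (Module.Projective Λ (P₀ × P)),
      hse.prod_right, hK⟩

theorem InAdd.prod {X Y T : Type u} [AddCommGroup X] [Module Λ X] [AddCommGroup Y] [Module Λ Y]
    [AddCommGroup T] [Module Λ T] (hX : InAdd Λ X T) (hY : InAdd Λ Y T) : InAdd Λ (X × Y) T := by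
  obtain ⟨m, i, p, h⟩ := hX
  obtain ⟨m', i', p', h'⟩ := hY
  refine ⟨m + m', IsSummand.trans ⟨i.prodMap i', p.prodMap p', ?_⟩
    (IsSummand.of_equiv ((LinearEquiv.sumArrowLequivProdArrow (Fin m) (Fin m') Λ T).symm.trans
      (LinearEquiv.funCongrLeft Λ T finSumFinEquiv.symm)))⟩
  rw [LinearMap.prodMap_comp, h, h', LinearMap.prodMap_id]

theorem IsShortExact.prod {U M W Z : Type u} [AddCommGroup U] [Module Λ U] [AddCommGroup M]
    [Module Λ M] [AddCommGroup W] [Module Λ W] [AddCommGroup Z] [Module Λ Z] {f : U →ₗ[Λ] M}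
    {g : M →ₗ[Λ] W} (h : IsShortExact f g) :
    IsShortExact ((LinearMap.id : Z →ₗ[Λ] Z).prodMap f) (g ∘ₗ LinearMap.snd Λ Z M) := by
  refine ⟨fun x y hxy => ?_, fun ⟨z, x⟩ => ⟨fun hx => ?_, ?_⟩, fun w => ?_⟩
  · have h1 : x.1 = y.1 := (Prod.ext_iff.1 hxy).1
    have h2 : f x.2 = f y.2 := (Prod.ext_iff.1 hxy).2
    exact Prod.ext h1 (h.1 h2)
  · obtain ⟨y, rfl⟩ := (h.2.1 x).1 hx
    exact ⟨(z, y), rfl⟩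
  · rintro ⟨⟨a, b⟩, hab⟩
    rw [← hab]
    exact h.2.1.apply_apply_eq_zero b
  · obtain ⟨x, rfl⟩ := h.2.2 w
    exact ⟨(0, x), rfl⟩

theorem IsShortExact.comp_equiv {U U' M W : Type u} [AddCommGroup U] [Module Λ U] [AddCommGroup U']
    [Module Λ U'] [AddCommGroup M] [Module Λ M] [AddCommGroup W] [Module Λ W] {f : U →ₗ[Λ] M}
    {g : M →ₗ[Λ] W} (h : IsShortExact f g) (e : U' ≃ₗ[Λ] U) :
    IsShortExact (f ∘ₗ e.toLinearMap) g := by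
  refine ⟨h.1.comp e.injective, fun x => (h.2.1 x).trans ?_, h.2.2⟩
  exact ⟨fun ⟨y, hy⟩ => ⟨e.symm y, by simpa using hy⟩, fun ⟨y, hy⟩ => ⟨e y, hy⟩⟩

end Resolutions

/-! ### Chains of Auslander–Reiten sequences: no X_j lies in add(M). -/

section Chain

variable {A : Type u} [Ring A] {X M : ℕ → Type u}
  [∀ i, AddCommGroup (X i)] [∀ i, Module A (X i)] [∀ i, AddCommGroup (M i)] [∀ i, Module A (M i)]
  {f : ∀ i, X (i + 1) →ₗ[A] M (i + 1)} {g : ∀ i, M (i + 1) →ₗ[A] X i} {n : ℕ}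

theorem isIndec_of_isARSequence (hn : 1 ≤ n) (h : ∀ i, i < n → IsARSequence (f i) (g i)) (j : ℕ)
    (hj : j ≤ n) : IsIndec A (X j) := by
  cases j with
  | zero => exact (h 0 hn).indec_right
  | succ j => exact (h j hj).indec_left

theorem finite_of_isARSequence (hn : 1 ≤ n) (h : ∀ i, i < n → IsARSequence (f i) (g i)) (j : ℕ)
    (hj : j ≤ n) : Module.Finite A (X j) := by
  cases j with
  | zero => exact (h 0 hn).finite_right
  | succ j => exact (h j hj).finite_left

theorem isLocalRing_end_of_isARSequence [IsArtinianRing A] (hn : 1 ≤ n) (h : ∀ i, i < n → IsARSequence (f i) (g i))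
    (j : ℕ) (hj : j ≤ n) : IsLocalRing (Module.End A (X j)) :=
  have := finite_of_isARSequence hn h j hj
  (isIndec_of_isARSequence hn h j hj).isLocalRing_end

/-- None of the modules `X j` is a direct summand of one of the middle terms. -/
theorem not_isSummand_middle [IsArtinianRing A] (hn : 1 ≤ n) (h : ∀ i, i < n → IsARSequence (f i) (g i))
    (hX : ∀ i, i < n → ¬ IsSummand A (X n) (M (i + 1))) (j : ℕ) (hj : j ≤ n) (i : ℕ) (hi : i < n) :
    ¬ IsSummand A (X j) (M (i + 1)) := by
  intro hs
  -- If X_j is a summand of M_{i+1} and j < n, then X_{i+1} is a summand of M_{j+1}. Replacing (i,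
  -- j) by (j, i+1) raises i + j by one while i + j stays below 2n, so j = n is eventually reached,
  -- which is excluded.
  obtain ⟨m, hm⟩ : ∃ m, 2 * n - (i + j) ≤ m := ⟨_, le_rfl⟩
  induction m generalizing i j with
  | zero => omega
  | succ m ih =>
    rcases hj.lt_or_eq with hj' | rfl
    · have := isLocalRing_end_of_isARSequence hn h j hj
      exact ih (i + 1) hi j hj' ((h i hi).isSummand_middle (h j hj') hs) (by omega)
    · exact hX i hi hs

end Chain

/-! ### The tilting property. -/

section Tilting

variable {A : Type u} [Ring A] {X M : ℕ → Type u}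
  [∀ i, AddCommGroup (X i)] [∀ i, Module A (X i)] [∀ i, AddCommGroup (M i)] [∀ i, Module A (M i)]
  {V P W : Type u} [AddCommGroup V] [Module A V] [AddCommGroup P] [Module A P]
  [AddCommGroup W] [Module A W]
  {f : ∀ i, X (i + 1) →ₗ[A] M (i + 1)} {g : ∀ i, M (i + 1) →ₗ[A] X i} {n : ℕ}

/-- Every linear map `Hom(V, X j) → Hom(V, W)` is induced by a linear map `X j → W`. -/
theorem exists_homMap_eq_of_chain (hse : ∀ i, i < n → IsShortExact (f i) (g i))
    (hX : IsSummand A (X n) V) (hM : ∀ i, i < n → IsSummand A (M (i + 1)) V)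
    (hlift : ∀ i, i < n → ∀ u : V →ₗ[A] X i, ∃ v : V →ₗ[A] M (i + 1), g i ∘ₗ v = u)
    (j : ℕ) (hj : j ≤ n) (F : HomModule A V (X j) →ₗ[EndRing A V] HomModule A V W) :
    ∃ z : X j →ₗ[A] W, F = homMap V z := by
  -- Each X_j is a quotient of a summand of V, so vanishing of a map out of X_{j+1} can be tested
  -- after applying Hom(V, -).
  have hgen : ∀ j, j ≤ n → ∃ (Q : ModuleCat.{u} A) (q : Q →ₗ[A] X j), IsSummand A Q V ∧
      Function.Surjective q := by
    intro j hj
    rcases hj.lt_or_eq with hj | rfl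
    · exact ⟨ModuleCat.of A (M (j + 1)), g j, hM j hj, (hse j hj).2.2⟩
    · exact ⟨ModuleCat.of A (X j), LinearMap.id, hX, Function.surjective_id⟩
  rcases hj.lt_or_eq with hj | rfl
  · obtain ⟨i, p, hip⟩ := hM j hj
    obtain ⟨y, hy⟩ := exists_homMap_eq hip (F ∘ₗ homMap V (g j))
    obtain ⟨Q, q, hQ, hq⟩ := hgen (j + 1) hj
    have h1 : (y ∘ₗ f j) ∘ₗ q = 0 := by
      refine homMap_injective hQ (LinearMap.ext fun (u : V →ₗ[A] Q) => ?_)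
      have h2 : (homMap V y) (toHom (f j ∘ₗ q ∘ₗ u)) = 0 := by
        rw [← hy]
        have h3 : homMap V (g j) (toHom (f j ∘ₗ q ∘ₗ u)) = 0 := by
          change (g j ∘ₗ f j) ∘ₗ (q ∘ₗ u) = 0
          rw [(hse j hj).comp_eq_zero, LinearMap.zero_comp]
        rw [LinearMap.comp_apply, h3, map_zero]
      exact h2
    obtain ⟨z, hz⟩ := exists_comp_eq_of_ker_le y (hse j hj).2.2 (by
      intro x hx
      obtain ⟨w, rfl⟩ := ((hse j hj).2.1 x).1 hx
      obtain ⟨w, rfl⟩ := hq w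
      exact LinearMap.congr_fun h1 w)
    refine ⟨z, LinearMap.ext fun u => ?_⟩
    obtain ⟨v, rfl⟩ := homMap_surjective_of_lift (hlift j hj) u
    have h4 := LinearMap.congr_fun hy v
    rw [← hz, homMap_comp] at h4
    exact h4
  · obtain ⟨i, p, hip⟩ := hX
    exact exists_homMap_eq hip F

/-- The lifting hypothesis makes the sequences exact under Hom(V, -). Read from the right they
resolve Hom(V, X_0) by projectives; read from the left they coresolve Hom(V, X_n) in add(T). The
extension hypotheses kill Ext. -/
theorem isTilting_of_chain (hn : 1 ≤ n) (hse : ∀ i, i < n → IsShortExact (f i) (g i))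
    (e : V ≃ₗ[A] P × X n) (hMP : ∀ i, i < n → IsSummand A (M (i + 1)) P)
    (hlift : ∀ i, i < n → ∀ u : V →ₗ[A] X i, ∃ v : V →ₗ[A] M (i + 1), g i ∘ₗ v = u)
    (hext₀ : ∀ i, i < n → ∀ u : X (i + 1) →ₗ[A] X 0, ∃ v : M (i + 1) →ₗ[A] X 0, v ∘ₗ f i = u)
    (hextP : ∀ i, i < n → ∀ u : X (i + 1) →ₗ[A] P, ∃ v : M (i + 1) →ₗ[A] P, v ∘ₗ f i = u) :
    IsTilting (EndRing A V) (HomModule A V (X 0) × HomModule A V P) := by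
  have hP : IsSummand A P V := isSummand_inl.trans (IsSummand.of_equiv e.symm)
  have hX : IsSummand A (X n) V := isSummand_inr.trans (IsSummand.of_equiv e.symm)
  have hM : ∀ i, i < n → IsSummand A (M (i + 1)) V := fun i hi => (hMP i hi).trans hP
  have hseH : ∀ i, i < n → IsShortExact (homMap V (f i)) (homMap V (g i)) := fun i hi =>
    (hse i hi).homMap (hlift i hi)
  have := homModule_projective hP
  have := homModule_finite hP
  have hT : InAdd (EndRing A V) (HomModule A V P) (HomModule A V (X 0) × HomModule A V P) :=
    isSummand_inr.inAdd
  have hMT : ∀ i, i < n → InAdd (EndRing A V) (HomModule A V (M (i + 1)))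
      (HomModule A V (X 0) × HomModule A V P) := fun i hi =>
    ((hMP i hi).homModule.trans isSummand_inr).inAdd
  refine ⟨⟨n, ?_⟩, fun i hi => ?_, ⟨n, ?_⟩⟩
  · refine HasProjRes.prod (X := ModuleCat.of _ (HomModule A V (X 0))) ?_ _
    have key : ∀ k j, j + k = n → HasProjRes k (ModuleCat.of (EndRing A V) (HomModule A V (X j))) := by
      intro k
      induction k with
      | zero =>
        rintro j rfl
        exact ⟨homModule_finite hX, homModule_projective hX⟩
      | succ k ih =>
        intro j hj
        exact ⟨ModuleCat.of _ (HomModule A V (X (j + 1))), ModuleCat.of _ (HomModule A V (M (j + 1))),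
          homMap V (f j), homMap V (g j), homModule_finite (hM j (by omega)),
          homModule_projective (hM j (by omega)), hseH j (by omega), ih (j + 1) (by omega)⟩
    exact key n 0 (zero_add n)
  · have hext : ∀ j, j < n → ∀ φ : HomModule A V (X (j + 1)) →ₗ[EndRing A V]
        HomModule A V (X 0) × HomModule A V P, ∃ ψ, ψ ∘ₗ homMap V (f j) = φ := by
      intro j hj φ
      obtain ⟨a, ha⟩ := exists_homMap_eq_of_chain hse hX hM hlift (j + 1) hj
        (LinearMap.fst _ _ _ ∘ₗ φ)
      obtain ⟨b, hb⟩ := exists_homMap_eq_of_chain hse hX hM hlift (j + 1) hj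
        (LinearMap.snd _ _ _ ∘ₗ φ)
      obtain ⟨a, rfl⟩ := hext₀ j hj a
      obtain ⟨b, rfl⟩ := hextP j hj b
      exact ⟨(homMap V a).prod (homMap V b), LinearMap.ext fun x =>
        Prod.ext (LinearMap.congr_fun ha x).symm (LinearMap.congr_fun hb x).symm⟩
    -- Descending induction on j, starting from the projective module Hom(V, X_n).
    have key : ∀ k j, j + k = n → ∀ i, ExtVanish (EndRing A V) (HomModule A V (X j))
        (HomModule A V (X 0) × HomModule A V P) (i + 1) := by
      intro k
      induction k with
      | zero =>
        rintro j rfl i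
        have := homModule_projective hX
        exact extVanish_of_projective i
      | succ k ih =>
        intro j hj i
        have := homModule_projective (hM j (by omega))
        cases i with
        | zero => exact extVanish_one_of_projective (hseH j (by omega)) (hext j (by omega))
        | succ i => exact extVanish_succ_of_projective (hseH j (by omega)) (ih (j + 1) (by omega) i)
    obtain ⟨i, rfl⟩ := Nat.exists_eq_add_of_le' hi
    have := homModule_projective (hM 0 hn)
    have hse0 := (hseH 0 hn).prod_right (Z := HomModule A V P)
    cases i with
    | zero =>
      refine extVanish_one_of_projective hse0 fun φ => ?_
      obtain ⟨ψ, hψ⟩ := hext 0 hn φ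
      exact ⟨ψ ∘ₗ LinearMap.fst _ _ _, hψ⟩
    | succ i => exact extVanish_succ_of_projective hse0 (key (n - 1) 1 (by omega) i)
  · have key : ∀ j, j ≤ n → HasAddCores (ModuleCat.of (EndRing A V)
        (HomModule A V (X 0) × HomModule A V P)) j
        (ModuleCat.of (EndRing A V) (HomModule A V (X j))) := by
      intro j
      induction j with
      | zero => exact fun _ => isSummand_inl.inAdd
      | succ j ih =>
        intro hj
        exact ⟨ModuleCat.of _ (HomModule A V (M (j + 1))), ModuleCat.of _ (HomModule A V (X j)),
          homMap V (f j), homMap V (g j), hMT j hj, hseH j hj, ih (by omega)⟩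
    obtain ⟨m, rfl⟩ := Nat.exists_eq_add_of_le' hn
    -- Λ is Hom(V, P) ⊕ Hom(V, X_n), so its coresolution is that of Hom(V, X_n) with the identity of
    -- Hom(V, P) added in the first step.
    let eH : HomModule A V V ≃ₗ[EndRing A V] HomModule A V (P × X (m + 1)) :=
      LinearEquiv.ofLinearMap (homMap V e.toLinearMap) (homMap V e.symm.toLinearMap)
        (by rw [← homMap_comp, LinearEquiv.comp_symm, homMap_id])
        (by rw [← homMap_comp, LinearEquiv.symm_comp, homMap_id])
    exact ⟨ModuleCat.of _ (HomModule A V P × HomModule A V (M (m + 1))),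
      ModuleCat.of _ (HomModule A V (X m)), _, _, hT.prod (hMT m (by omega)),
      (hseH m (by omega)).prod.comp_equiv
        (((regularEquiv A V).trans eH).trans (homModuleProd A V P (X (m + 1)))),
      key m (by omega)⟩

end Tilting

/-! ### Splicing, and the proof of the Auslander–Reiten case. -/

section Splice

variable {A : Type u} [Ring A] {X M : ℕ → Type u}
  [∀ i, AddCommGroup (X i)] [∀ i, Module A (X i)] [∀ i, AddCommGroup (M i)] [∀ i, Module A (M i)]

/-- The terms `X 0, M 1, …, M n, X n` of the long exact sequence obtained by splicing short exact
sequences `0 → X (i+1) → M (i+1) → X i → 0` for `i < n`. -/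
theorem exists_splice (n : ℕ) (f : ∀ i, X (i + 1) →ₗ[A] M (i + 1)) (g : ∀ i, M (i + 1) →ₗ[A] X i) :
    ∃ (N : ℕ → ModuleCat.{u} A) (a : ∀ i, N (i + 1) →ₗ[A] X i) (b : ∀ i, X i →ₗ[A] N i)
      (eM : ∀ i, i < n → (N (i + 1) ≃ₗ[A] M (i + 1))) (eX : N (n + 1) ≃ₗ[A] X n)
      (e₀ : X 0 ≃ₗ[A] N 0), (∀ i hi, a i = g i ∘ₗ (eM i hi).toLinearMap) ∧
      (∀ i hi, b (i + 1) = (eM i hi).symm.toLinearMap ∘ₗ f i) ∧ a n = eX.toLinearMap ∧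
      b 0 = e₀.toLinearMap := by
  classical
  obtain ⟨N, h0, h1, h2⟩ : ∃ N : ℕ → ModuleCat.{u} A, N 0 = ModuleCat.of A (X 0) ∧
      (∀ i, i < n → N (i + 1) = ModuleCat.of A (M (i + 1))) ∧
      ∀ i, ¬ i < n → N (i + 1) = ModuleCat.of A (X i) :=
    -- Of the values N_{i+1} = X_i with i ≥ n, only N_{n+1} = X_n matters.
    ⟨fun i => Nat.casesOn i (ModuleCat.of A (X 0))
      fun i => if i < n then ModuleCat.of A (M (i + 1)) else ModuleCat.of A (X i), rfl,
      fun _ hi => if_pos hi, fun _ hi => if_neg hi⟩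
  let e₀ : X 0 ≃ₗ[A] N 0 := (eqToIso h0.symm).toLinearEquiv
  let eM : ∀ i, i < n → (N (i + 1) ≃ₗ[A] M (i + 1)) := fun i hi => (eqToIso (h1 i hi)).toLinearEquiv
  let eX : ∀ i, ¬ i < n → (N (i + 1) ≃ₗ[A] X i) := fun i hi => (eqToIso (h2 i hi)).toLinearEquiv
  let a : ∀ i, N (i + 1) →ₗ[A] X i := fun i =>
    if hi : i < n then g i ∘ₗ (eM i hi).toLinearMap else (eX i hi).toLinearMap
  let b : ∀ i, X i →ₗ[A] N i := fun i => Nat.casesOn i e₀.toLinearMap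
    fun j => if hj : j < n then (eM j hj).symm.toLinearMap ∘ₗ f j else 0
  exact ⟨N, a, b, eM, eX n (lt_irrefl n), e₀, fun i hi => dif_pos hi,
    fun i hi => dif_pos hi, dif_neg (lt_irrefl n), rfl⟩

end Splice

/-- Auslander-Reiten sequences `0 → X (i+1) → M (i+1) → X i → 0` for `i < n` give a module which is
tilting and `n`-BB-tilting. -/
theorem isTilting_and_isNBBTilting_of_isARSequence {n : ℕ} (hn : 1 ≤ n) (R A : Type u) [CommRing R]
    [IsArtinianRing R] [Ring A] [Algebra R A] [Module.Finite R A] (X M : ℕ → Type u)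
    [∀ i, AddCommGroup (X i)] [∀ i, Module R (X i)] [∀ i, Module A (X i)]
    [∀ i, IsScalarTower R A (X i)]
    [∀ i, AddCommGroup (M i)] [∀ i, Module R (M i)] [∀ i, Module A (M i)]
    [∀ i, IsScalarTower R A (M i)]
    (f : ∀ i, X (i + 1) →ₗ[A] M (i + 1)) (g : ∀ i, M (i + 1) →ₗ[A] X i)
    (h : ∀ i, i < n → IsARSequence (f i) (g i))
    (hadd : ¬ InAdd A (X n) (Π i : Fin n, M (i + 1)))
    (hiso : ∀ i j, i ≤ n → j ≤ n → i ≠ j → IsEmpty (X i ≃ₗ[A] X j)) :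
    IsTilting (EndRing A ((Π i : Fin n, M (i + 1)) × X n))
      (HomModule A ((Π i : Fin n, M (i + 1)) × X n) (X 0) ×
        HomModule A ((Π i : Fin n, M (i + 1)) × X n) (Π i : Fin n, M (i + 1))) ∧
    IsNBBTilting R (EndRing A ((Π i : Fin n, M (i + 1)) × X n)) n
      (HomModule A ((Π i : Fin n, M (i + 1)) × X n) (X 0) ×
        HomModule A ((Π i : Fin n, M (i + 1)) × X n) (Π i : Fin n, M (i + 1))) := by
  have : IsArtinianRing A := IsArtinianRing.of_finite R A
  have hXfin := finite_of_isARSequence hn h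
  have hXind := isIndec_of_isARSequence hn h
  have hXloc := isLocalRing_end_of_isARSequence hn h
  have : ∀ i : Fin n, Module.Finite A (M (i + 1)) := fun i => (h i i.2).finite_middle
  have : ∀ i : Fin n, Module.Finite R (M (i + 1)) := fun i => Module.Finite.trans A _
  have := hXfin n le_rfl
  have : Module.Finite R (X n) := Module.Finite.trans A _
  have := hXfin 0 (Nat.zero_le n)
  have hMP : ∀ i, i < n → IsSummand A (M (i + 1)) (Π i : Fin n, M (i + 1)) := fun i hi =>
    isSummand_pi (Y := fun i : Fin n => M (i + 1)) ⟨i, hi⟩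
  have hXM : ∀ j, j ≤ n → ¬ IsSummand A (X j) (Π i : Fin n, M (i + 1)) := by
    intro j hj hs
    have := hXloc j hj
    obtain ⟨i, hi⟩ := hs.exists_of_pi
    exact not_isSummand_middle hn h (fun i hi hs => hadd (hs.trans (hMP i hi)).inAdd) j hj i i.2 hi
  have hXX : ∀ i j, i ≤ n → j ≤ n → i ≠ j → ¬ IsSummand A (X i) (X j) := by
    intro i j hi hj hij hs
    have := (hXind i hi).1
    obtain ⟨e⟩ := hs.nonempty_equiv (hXind j hj)
    exact (hiso i j hi hj hij).false e
  -- The case j = n is excluded since X_n is a summand of V; for j < n pairwise non-isomorphism is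
  -- what rules out the factor X_n.
  have hXV : ∀ j, j < n → ¬ IsSummand A (X j) ((Π i : Fin n, M (i + 1)) × X n) := by
    intro j hj hs
    have := hXloc j hj.le
    exact hs.or_of_prod.elim (hXM j hj.le) (hXX j n hj.le le_rfl hj.ne)
  have hlift : ∀ i, i < n → ∀ u : (Π i : Fin n, M (i + 1)) × X n →ₗ[A] X i,
      ∃ v : (Π i : Fin n, M (i + 1)) × X n →ₗ[A] M (i + 1), g i ∘ₗ v = u := fun i hi u =>
    (h i hi).exists_lift (hXV i hi) u
  refine ⟨isTilting_of_chain hn (fun i hi => (h i hi).shortExact) (LinearEquiv.refl A _) hMP hlift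
    (fun i hi u => (h i hi).exists_extension (hXX _ _ hi (Nat.zero_le n) (Nat.succ_ne_zero i)) u)
    (fun i hi u => (h i hi).exists_extension (hXM _ hi) u), ?_⟩
  obtain ⟨N, a, b, eM, eX, e₀, ha, hb, han, hb0⟩ := exists_splice n f g
  have hasurj : ∀ i, i ≤ n → Function.Surjective (a i) := by
    intro i hi
    rcases hi.lt_or_eq with hi | rfl
    · rw [ha i hi]
      exact (h i hi).shortExact.2.2.comp (eM i hi).surjective
    · rw [han]
      exact eX.surjective
  have hbinj : ∀ i, i ≤ n → Function.Injective (b i) := by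
    intro i hi
    cases i with
    | zero => rw [hb0]; exact e₀.injective
    | succ i =>
      rw [hb i hi]
      exact (eM i hi).symm.injective.comp (h i hi).shortExact.1
  have hab : ∀ i, i < n → Function.Exact (b (i + 1)) (a i) := by
    intro i hi x
    rw [ha i hi, hb i hi]
    refine ((h i hi).shortExact.2.1 (eM i hi x)).trans ⟨?_, ?_⟩
    · rintro ⟨y, hy⟩
      exact ⟨y, by simp [hy]⟩
    · rintro ⟨y, rfl⟩
      exact ⟨y, by simp⟩
  have halift : ∀ i, i ≤ n → ∀ u : (Π i : Fin n, M (i + 1)) × X n →ₗ[A] X i,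
      ∃ v : (Π i : Fin n, M (i + 1)) × X n →ₗ[A] N (i + 1), a i ∘ₗ v = u := by
    intro i hi u
    rcases hi.lt_or_eq with hi | rfl
    · obtain ⟨v, rfl⟩ := hlift i hi u
      refine ⟨(eM i hi).symm.toLinearMap ∘ₗ v, ?_⟩
      rw [ha i hi]
      ext x <;> simp
    · refine ⟨eX.symm.toLinearMap ∘ₗ u, ?_⟩
      rw [han, ← LinearMap.comp_assoc, LinearEquiv.comp_symm, LinearMap.id_comp]
  -- For i = 0 the map b_0 is an isomorphism; for 0 < i < n, X_i is not a summand of V, so left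
  -- almost splitness applies.
  have hbext : ∀ i, i < n → ∀ u : X i →ₗ[A] (Π i : Fin n, M (i + 1)) × X n,
      ∃ v : N i →ₗ[A] (Π i : Fin n, M (i + 1)) × X n, v ∘ₗ b i = u := by
    intro i hi u
    cases i with
    | zero =>
      refine ⟨u ∘ₗ e₀.symm.toLinearMap, ?_⟩
      rw [hb0, LinearMap.comp_assoc, LinearEquiv.symm_comp, LinearMap.comp_id]
    | succ i =>
      obtain ⟨v, rfl⟩ := (h i (by omega)).exists_extension (hXV _ hi) u
      refine ⟨v ∘ₗ (eM i (by omega)).toLinearMap, ?_⟩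
      rw [hb i (by omega), LinearMap.comp_assoc, ← LinearMap.comp_assoc (f i),
        LinearEquiv.comp_symm, LinearMap.id_comp]
  have hbn : IsRadical (b n) ∧ ∀ u : X n →ₗ[A] (Π i : Fin n, M (i + 1)) × X n, IsRadical u →
      ∃ v : N n →ₗ[A] (Π i : Fin n, M (i + 1)) × X n, v ∘ₗ b n = u := by
    obtain ⟨m, rfl⟩ := Nat.exists_eq_add_of_le' hn
    have hm : m < m + 1 := Nat.lt_succ_self m
    have := hXloc (m + 1) le_rfl
    have := (hXind (m + 1) le_rfl).1
    rw [hb m hm]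
    refine ⟨((h m hm).isRadical_left).comp_left _, fun u hu => ?_⟩
    obtain ⟨v, rfl⟩ := (h m hm).left_almost_split (ModuleCat.of A _) inferInstance u
      fun ⟨r, hr⟩ => hu.no_retraction r hr
    refine ⟨v ∘ₗ (eM m hm).toLinearMap, ?_⟩
    rw [LinearMap.comp_assoc, ← LinearMap.comp_assoc (f m), LinearEquiv.comp_symm,
      LinearMap.id_comp]
  have hNind := (hXind n le_rfl).congr eX.symm
  have : Module.Finite A (N (n + 1)) := Module.Finite.equiv eX.symm
  have := hNind.isLocalRing_end
  have hNP : ∀ i, i < n → IsSummand A (N (i + 1)) (Π i : Fin n, M (i + 1)) := fun i hi =>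
    (IsSummand.of_equiv (eM i hi)).trans (hMP i hi)
  have hcomp : ∀ i, i < n → (b i ∘ₗ a i) ∘ₗ (b (i + 1) ∘ₗ a (i + 1)) = 0 := by
    intro i hi
    rw [LinearMap.comp_assoc, ← LinearMap.comp_assoc (a (i + 1)),
      (hab i hi).linearMap_comp_eq_zero, LinearMap.zero_comp, LinearMap.comp_zero]
  -- Every map V → X_0 lifts to M_1, so here the image L is all of Hom(V, X_0).
  have hrange : LinearMap.range (homMap ((Π i : Fin n, M (i + 1)) × X n) (b 0 ∘ₗ a 0)) = ⊤ := by
    refine LinearMap.range_eq_top.2 (homMap_surjective_of_lift fun u => ?_)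
    obtain ⟨v, hv⟩ := halift 0 (Nat.zero_le n) (e₀.symm.toLinearMap ∘ₗ u)
    refine ⟨v, ?_⟩
    rw [LinearMap.comp_assoc, hv, hb0, ← LinearMap.comp_assoc, LinearEquiv.comp_symm,
      LinearMap.id_comp]
  let eH : HomModule A ((Π i : Fin n, M (i + 1)) × X n) (X 0) ≃ₗ[EndRing A _]
      HomModule A ((Π i : Fin n, M (i + 1)) × X n) (N 0) :=
    LinearEquiv.ofLinearMap (homMap _ e₀.toLinearMap) (homMap _ e₀.symm.toLinearMap)
      (by rw [← homMap_comp, LinearEquiv.comp_symm, homMap_id])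
      (by rw [← homMap_comp, LinearEquiv.symm_comp, homMap_id])
  refine isNBBTilting_of_sequence (N := fun i => N i) (d := fun i => b i ∘ₗ a i) hn hNind.1
    (fun i hi => ?_) (fun i hi => ?_) ?_ (fun i hi => ?_) (fun i hi => ?_) (fun u hu => ?_)
    (LinearEquiv.prodCongr (LinearEquiv.refl A _) eX.symm)
    (fun hs => hXM n le_rfl ((IsSummand.of_equiv eX.symm).trans hs)) hNP
    (LinearEquiv.prodCongr (eH.trans (LinearEquiv.ofTop _ hrange).symm) (LinearEquiv.refl _ _))
  · rcases hi.lt_or_eq with hi | rfl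
    · exact (hNP i hi).trans isSummand_inl
    · exact (IsSummand.of_equiv eX).trans isSummand_inr
  · rcases hi.lt_or_eq with hi | rfl
    · have := hXloc i hi.le
      refine IsRadical.comp_left ?_ _
      rw [ha i hi]
      exact ((h i hi).isRadical_right).comp_right _
    · exact hbn.1.comp_right _
  · refine (hbinj n le_rfl).comp ?_
    rw [han]
    exact eX.injective
  · intro u
    constructor
    · intro hu
      have hu' : u ∘ₗ b (i + 1) = 0 := LinearMap.ext fun x => by
        obtain ⟨y, rfl⟩ := hasurj (i + 1) hi x
        exact LinearMap.congr_fun hu y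
      obtain ⟨w, hw⟩ := exists_comp_eq_of_ker_le u (hasurj i hi.le) (by
        intro x hx
        obtain ⟨y, rfl⟩ := (hab i hi x).1 hx
        exact LinearMap.congr_fun hu' y)
      obtain ⟨v, rfl⟩ := hbext i hi w
      exact ⟨v, hw⟩
    · rintro ⟨v, rfl⟩
      change v ∘ₗ ((b i ∘ₗ a i) ∘ₗ (b (i + 1) ∘ₗ a (i + 1))) = 0
      rw [hcomp i hi, LinearMap.comp_zero]
  · intro u
    constructor
    · intro hu
      have hu' : ∀ x, u x ∈ LinearMap.range (b (i + 1)) := fun x => by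
        refine (hab i hi _).1 (hbinj i hi.le ?_)
        rw [map_zero]
        exact LinearMap.congr_fun hu x
      obtain ⟨v, hv⟩ := halift (i + 1) hi
        ((LinearEquiv.ofInjective _ (hbinj (i + 1) hi)).symm.toLinearMap ∘ₗ u.codRestrict _ hu')
      refine ⟨v, LinearMap.ext fun x => ?_⟩
      have h1 := congrArg (b (i + 1)) (LinearMap.congr_fun hv x)
      refine h1.trans ?_
      exact congrArg Subtype.val ((LinearEquiv.ofInjective _ (hbinj (i + 1) hi)).apply_symm_apply
        (u.codRestrict _ hu' x))
    · rintro ⟨v, rfl⟩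
      change ((b i ∘ₗ a i) ∘ₗ (b (i + 1) ∘ₗ a (i + 1))) ∘ₗ v = 0
      rw [hcomp i hi, LinearMap.zero_comp]
  · obtain ⟨v, hv⟩ := hbn.2 (u ∘ₗ eX.symm.toLinearMap) fun w => by
      exact hu.comp_right eX.symm.toLinearMap w
    refine ⟨v, ?_⟩
    change v ∘ₗ (b n ∘ₗ a n) = u
    rw [← LinearMap.comp_assoc, hv, han, LinearMap.comp_assoc, LinearEquiv.symm_comp,
      LinearMap.comp_id]

end BBTilting

open BBTilting in
theorem proposition4p3 (n : ℕ) (hn : 1 ≤ n) :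
    -- (1)
    (∀ (R A : Type u) [CommRing R] [IsArtinianRing R] [Ring A] [Algebra R A] [Module.Finite R A]
      (X M : ℕ → Type u)
      [∀ i, AddCommGroup (X i)] [∀ i, Module R (X i)] [∀ i, Module A (X i)]
      [∀ i, IsScalarTower R A (X i)]
      [∀ i, AddCommGroup (M i)] [∀ i, Module R (M i)] [∀ i, Module A (M i)]
      [∀ i, IsScalarTower R A (M i)]
      (f : ∀ i, X (i + 1) →ₗ[A] M (i + 1)) (g : ∀ i, M (i + 1) →ₗ[A] X i),
      (∀ i, i < n → IsARSequence (f i) (g i)) →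
      ¬ InAdd A (X n) (Π i : Fin n, M (i + 1)) →
      (∀ i j, i ≤ n → j ≤ n → i ≠ j → IsEmpty (X i ≃ₗ[A] X j)) →
      let V := (Π i : Fin n, M (i + 1)) × X n
      let T := HomModule A V (X 0) × HomModule A V (Π i : Fin n, M (i + 1))
      IsTilting (EndRing A V) T ∧ IsNBBTilting R (EndRing A V) n T) ∧
    -- (2)
    (∀ (k A : Type u) [Field k] [Ring A] [Algebra k A] [Module.Finite k A]
      (C : CategoryTheory.ObjectProperty (ModuleCat.{u} A)) (N : ℕ → Type u)
      [∀ i, AddCommGroup (N i)] [∀ i, Module k (N i)] [∀ i, Module A (N i)]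
      [∀ i, IsScalarTower k A (N i)]
      (d : ∀ i, N (i + 1) →ₗ[A] N i),
      IsMaxOrthogonal C (n - 1) →
      IsIndec A (N (n + 1)) → IsIndec A (N 0) →
      IsNAlmostSplit C n d →
      ¬ InAdd A (N (n + 1)) (Π i : Fin n, N (i + 1)) →
      let V := (Π i : Fin n, N (i + 1)) × N (n + 1)
      let L := LinearMap.range (homMap V (d 0))
      IsNBBTilting k (EndRing A V) n (HomModule A V (Π i : Fin n, N (i + 1)) × L)) :=
  ⟨fun R A _ _ _ _ _ X M _ _ _ _ _ _ _ _ f g h hadd hiso =>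
    isTilting_and_isNBBTilting_of_isARSequence hn R A X M f g h hadd hiso,
  fun k A _ _ _ _ C N _ _ _ _ d hC hX _ hd hadd =>
    isNBBTilting_of_isNAlmostSplit hn k A C N d hC.finite hX hd hadd⟩
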